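/- Let $\Delta$ be a pinwheel triangulation (interior cell) with $n$ triangles: a finite simplicial complex embedded in $\mathbb{R}^2$ with a unique vertex $O$ in the interior of its underlying set, such that every simplex is a face of a triangle of $\Delta$ having $O$ as a vertex. For an integer $d\ge 0$ let $S^1_d(\Delta)$ be the real vector space of functions $F:\Delta\to\mathbb{R}$ that are continuously differentiable on $\Delta$ (as a subspace of $\mathbb{R}^2$) and whose restriction to each triangle is a polynomial of degree at most $d$. The vertex $O$ is called singular if it lies on exactly four triangles and the edges containing $O$ span exactly two distinct lines. Put $m_d = 1+\cdots+(d+1)=\frac{(d+1)(d+2)}{2}$. If $\Delta$ has four triangles and $O$ is singular, then \[ \dim_{\mathbb{R}} S^1_d(\Delta)=\begin{cases} m_d & \text{if } d\le 1,\\ m_d+2m_{d-2} & \text{if } 2\le d\le 3,\\ m_d+2m_{d-2}+m_{d-4} & \text{if } d\ge 4.\end{cases} \] If $\Delta$ has $n\ge 3$ triangles and $O$ is not singular, then \[ \dim_{\mathbb{R}} S^1_d(\Delta)=\begin{cases} m_d & \text{if } d\le 1,\\ m_d+(n-3)m_{d-2} & \text{if } d=2,\\ m_d+(n-3)m_{d-2}+2m_{d-3}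 & \text{if } d\ge 3.\end{cases} \] -/

import Mathlib

open Geometry

noncomputable section

/-- The (underlying vertex sets of the) top-dimensional simplices of a simplicial complex
in `ℝᵐ`. -/
def topSimplices {m : ℕ} (Δ : SimplicialComplex ℝ (EuclideanSpace ℝ (Fin m))) :
    Set (Finset (EuclideanSpace ℝ (Fin m))) :=
  {t | t ∈ Δ.faces ∧ t.card = m + 1}

/-- `F : Δ → ℝ` is given on each top-dimensional simplex of `Δ` by a polynomial of total
degree at most `d`. -/
def IsPiecewisePolynomial {m : ℕ} (Δ : SimplicialComplex ℝ (EuclideanSpace ℝ (Fin m)))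
    (d : ℕ) (F : Δ.space → ℝ) : Prop :=
  ∀ t ∈ topSimplices Δ, ∃ p : MvPolynomial (Fin m) ℝ, p.totalDegree ≤ d ∧
    ∀ x : Δ.space, (x : EuclideanSpace ℝ (Fin m)) ∈
      convexHull ℝ (t : Set (EuclideanSpace ℝ (Fin m))) →
        F x = MvPolynomial.eval (fun i => (x : EuclideanSpace ℝ (Fin m)) i) p

/-- `F : Δ → ℝ` is of class `C^r` as a function on the subspace `Δ ⊆ ℝᵐ`. (The extension by
zero only serves to make `F` a function on `ℝᵐ`; being `C^r` on the set `Δ.space` depends only on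
the values taken on that set.) -/
def IsContDiffOnSpace {m : ℕ} (Δ : SimplicialComplex ℝ (EuclideanSpace ℝ (Fin m)))
    (r : ℕ) (F : Δ.space → ℝ) : Prop :=
  ContDiffOn ℝ (r : WithTop ℕ∞) (Function.extend Subtype.val F 0) Δ.space

/-- The real vector space `S^r_d(Δ)` of splines: functions `Δ → ℝ` that are polynomials of degree
at most `d` on each top-dimensional simplex and of class `C^r`. -/
def splineSpace {m : ℕ} (Δ : SimplicialComplex ℝ (EuclideanSpace ℝ (Fin m))) (r d : ℕ) :
    Submodule ℝ (Δ.space → ℝ) where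
  carrier := {F | IsPiecewisePolynomial Δ d F ∧ IsContDiffOnSpace Δ r F}
  zero_mem' := by
    refine ⟨fun t _ => ⟨0, by simp, by simp⟩, ?_⟩
    refine (contDiffOn_const (c := (0 : ℝ))).congr fun x hx => ?_
    exact Subtype.val_injective.extend_apply (0 : Δ.space → ℝ) 0 ⟨x, hx⟩
  add_mem' := by
    rintro F G ⟨hF, hF'⟩ ⟨hG, hG'⟩
    refine ⟨fun t ht => ?_, ?_⟩
    · obtain ⟨p, hp, hp'⟩ := hF t ht
      obtain ⟨q, hq, hq'⟩ := hG t ht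
      refine ⟨p + q, (MvPolynomial.totalDegree_add p q).trans (max_le hp hq), fun x hx => ?_⟩
      simp [hp' x hx, hq' x hx]
    · refine (ContDiffOn.add hF' hG').congr fun x hx => ?_
      have h (H : Δ.space → ℝ) := Subtype.val_injective.extend_apply H 0 ⟨x, hx⟩
      simp only at h
      simp [h]
  smul_mem' := by
    rintro c F ⟨hF, hF'⟩
    refine ⟨fun t ht => ?_, ?_⟩
    · obtain ⟨p, hp, hp'⟩ := hF t ht
      refine ⟨c • p, (MvPolynomial.totalDegree_smul_le c p).trans hp, fun x hx => ?_⟩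
      simp [hp' x hx]
    · refine (ContDiffOn.const_smul c hF').congr fun x hx => ?_
      have h (H : Δ.space → ℝ) := Subtype.val_injective.extend_apply H 0 ⟨x, hx⟩
      simp only at h
      simp [h]

/-- `Δ` is a pinwheel triangulation (interior cell) in the plane with center `O`: a finite
simplicial complex whose only interior vertex is `O` and in which all triangles radiate
around `O`, that is, each simplex is a face of a triangle having `O` as a vertex. -/
structure IsPinwheel (Δ : SimplicialComplex ℝ (EuclideanSpace ℝ (Fin 2)))
    (O : EuclideanSpace ℝ (Fin 2)) : Prop where
  finite : Δ.faces.Finite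
  center_mem : O ∈ Δ.vertices
  center_interior : O ∈ interior Δ.space
  center_unique : ∀ v ∈ Δ.vertices, v ∈ interior Δ.space → v = O
  radiate : ∀ s ∈ Δ.faces, ∃ t ∈ topSimplices Δ, s ⊆ t ∧ O ∈ t

/-- The lines in the plane spanned by the edges of `Δ` that contain the vertex `O`. -/
def linesAt (Δ : SimplicialComplex ℝ (EuclideanSpace ℝ (Fin 2)))
    (O : EuclideanSpace ℝ (Fin 2)) : Set (AffineSubspace ℝ (EuclideanSpace ℝ (Fin 2))) :=
  {L | ∃ s ∈ Δ.faces, s.card = 2 ∧ O ∈ s ∧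
    L = affineSpan ℝ (s : Set (EuclideanSpace ℝ (Fin 2)))}

/-- `O` is a singular vertex of `Δ`: an interior vertex contained in exactly four triangles, such
that the edges at `O` lie on exactly two distinct lines. (The dual graph around `O` is a
four-cycle, and its edge-labels are given by these lines.) -/
def IsSingularVertex (Δ : SimplicialComplex ℝ (EuclideanSpace ℝ (Fin 2)))
    (O : EuclideanSpace ℝ (Fin 2)) : Prop :=
  O ∈ Δ.vertices ∧ O ∈ interior Δ.space ∧
    {t | t ∈ topSimplices Δ ∧ O ∈ t}.ncard = 4 ∧ (linesAt Δ O).ncard = 2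

/-- `m_d = 1 + 2 + ⋯ + (d + 1) = (d + 1)(d + 2) / 2`, the number of monomials of degree at most
`d` in two variables (the division is exact). -/
def numMonomials (d : ℕ) : ℕ := (d + 1) * (d + 2) / 2

end

/-! Walk once counterclockwise around `O`. The triangles are `O, v, σ v`, where `σ` is a permutation
of the neighbours `v` of `O` with a single cycle. A spline amounts to a tuple of polynomials `p v`
of degree at most `d`. Across the edge from `O` to `σ v` it is of class C¹ exactly when `p (σ v) - p
v` is divisible by the square of the linear form of that edge (`lineForm_sq_dvd_of_isFlat`,
`isFlat_of_mem_smoothTuples`, `map_glue_smoothTuples`).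

Write `A v` for the multiples of this square. The difference map on such tuples has the constant
tuples as kernel, and its image consists of all tuples with entries in the `A v` and sum zero. Hence
the dimension is `m_d + ∑ dim (A v) - dim (∑ A v)` (`finrank_cyclicSpace`). Each `A v` is zero for
`d ≤ 1` and has dimension `m_{d-2}` otherwise, so only the sum of the `A v` depends on the geometry.

If the edges lie on two lines, the sum has two distinct summands. They intersect in the multiples of
a polynomial of degree four, whence the term `m_{d-4}` (`sqMultiples_inf`). If three edges have
pairwise distinct lines, the product of two of the linear forms is a combination of the three
squares. The sum is then everything that vanishes to second order at `O`, of codimension 3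
(`iSup_sqMultiples_eq`). A vertex that is not singular always has three such edges
(`isSingularVertex_of_two_lines`, `exists_three_lines`). -/

noncomputable section

open MvPolynomial Module

/-! ### Dimensions of spaces of polynomials and of multiples of a fixed polynomial -/

/-- Bivariate real polynomials of total degree at most `d`. -/
abbrev PolyDeg (d : ℕ) : Submodule ℝ (MvPolynomial (Fin 2) ℝ) := restrictTotalDegree (Fin 2) ℝ d

lemma numMonomials_succ (d : ℕ) : numMonomials (d + 1) = numMonomials d + (d + 2) := by
  unfold numMonomials
  rw [show (d + 1 + 1) * (d + 1 + 2) = (d + 1) * (d + 2) + (d + 2) * 2 by ring]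
  exact Nat.add_mul_div_right _ _ (by norm_num)

lemma card_pairs_sum_le (d : ℕ) : Nat.card {p : ℕ × ℕ // p.1 + p.2 ≤ d} = numMonomials d := by
  classical
  have h : ∀ p : ℕ × ℕ, p.1 + p.2 ≤ d ↔
      p ∈ (Finset.range (d + 1)).biUnion fun k => Finset.HasAntidiagonal.antidiagonal k := by
    intro p
    simp
  rw [Nat.card_congr (Equiv.subtypeEquivRight h), Nat.card_eq_fintype_card, Fintype.card_coe,
    Finset.card_biUnion]
  · induction d with
    | zero => simp [numMonomials]
    | succ d ih =>
      rw [Finset.sum_range_succ, ih fun p => by simp, numMonomials_succ]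
      simp
  · intro i _ j _ hij
    refine Finset.disjoint_left.2 fun p hi hj => ?_
    exact hij ((Finset.HasAntidiagonal.mem_antidiagonal.1 hi).symm.trans
      (Finset.HasAntidiagonal.mem_antidiagonal.1 hj))

lemma finrank_polyDeg (d : ℕ) : finrank ℝ (PolyDeg d) = numMonomials d := by
  refine (finrank_eq_nat_card_basis
    (basisRestrictSupport ℝ {s : Fin 2 →₀ ℕ | (s.sum fun _ e => e) ≤ d})).trans ?_
  rw [← card_pairs_sum_le]
  refine Nat.card_congr (Equiv.subtypeEquiv
    (Finsupp.equivFunOnFinite.trans (finTwoArrowEquiv ℕ)) fun s => ?_)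
  simp [Finsupp.sum_fintype]

/-- The polynomials of total degree at most `d` that are divisible by `g`. -/
def multiples (g : MvPolynomial (Fin 2) ℝ) (d : ℕ) : Submodule ℝ (PolyDeg d) :=
  ((Ideal.span {g}).restrictScalars ℝ).comap (PolyDeg d).subtype

lemma mem_multiples {g : MvPolynomial (Fin 2) ℝ} {d : ℕ} {p : PolyDeg d} :
    p ∈ multiples g d ↔ g ∣ (p : MvPolynomial (Fin 2) ℝ) := by
  simp [multiples, Ideal.mem_span_singleton]

lemma totalDegree_mul_le_iff {g q : MvPolynomial (Fin 2) ℝ} {k e : ℕ} (hg : g ≠ 0)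
    (hk : g.totalDegree = k) : (g * q).totalDegree ≤ k + e ↔ q.totalDegree ≤ e := by
  rcases eq_or_ne q 0 with rfl | hq
  · simp
  · rw [totalDegree_mul_of_isDomain hg hq, hk]; omega

/-- Degrees add in a domain, so multiplication by `g` identifies the polynomials of degree at most
`e` with these multiples. -/
lemma finrank_multiples {g : MvPolynomial (Fin 2) ℝ} {k : ℕ} (e : ℕ) (hg : g ≠ 0)
    (hk : g.totalDegree = k) : finrank ℝ (multiples g (k + e)) = numMonomials e := by
  rw [← finrank_polyDeg]
  let f : PolyDeg e →ₗ[ℝ] PolyDeg (k + e) :=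
    ((LinearMap.mulLeft ℝ g).comp (PolyDeg e).subtype).codRestrict _ fun q => by
      rw [mem_restrictTotalDegree]
      exact (totalDegree_mul_le_iff hg hk).2 ((mem_restrictTotalDegree _ _ _).1 q.2)
  have hf : Function.Injective f := by
    intro a b h
    have := congrArg Subtype.val h
    exact Subtype.ext (mul_left_cancel₀ hg this)
  have hr : LinearMap.range f = multiples g (k + e) := by
    ext p
    rw [mem_multiples]
    constructor
    · rintro ⟨q, rfl⟩
      exact ⟨q, rfl⟩
    · rintro ⟨q, hq⟩
      refine ⟨⟨q, ?_⟩, Subtype.ext hq.symm⟩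
      rw [mem_restrictTotalDegree, ← totalDegree_mul_le_iff hg hk, ← hq]
      exact (mem_restrictTotalDegree _ _ _).1 p.2
  rw [← hr, LinearMap.finrank_range_of_inj hf]

lemma multiples_eq_bot {g : MvPolynomial (Fin 2) ℝ} {d : ℕ} (hd : d < g.totalDegree) :
    multiples g d = ⊥ := by
  rw [eq_bot_iff]
  intro p hp
  obtain ⟨q, hq⟩ := mem_multiples.1 hp
  by_contra h
  have hp0 : (p : MvPolynomial (Fin 2) ℝ) ≠ 0 := fun h0 => h (Subtype.ext h0)
  have h1 := (mem_restrictTotalDegree _ _ _).1 p.2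
  have hg : g ≠ 0 := by rintro rfl; simp_all
  have hq0 : q ≠ 0 := by rintro rfl; simp_all
  rw [hq, totalDegree_mul_of_isDomain hg hq0] at h1
  omega

/-! ### Linear algebra of tuples around a cycle -/

section Cyclic

variable {V P : Type*} [AddCommGroup P] [Module ℝ P]

/-- The tuples whose differences along the permutation `σ` lie in prescribed subspaces. -/
def cyclicSpace (σ : Equiv.Perm V) (A : V → Submodule ℝ P) : Submodule ℝ (V → P) where
  carrier := {p | ∀ v, p (σ v) - p v ∈ A v}
  zero_mem' := fun v => by simp
  add_mem' := fun {p q} hp hq v => by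
    have : (p + q) (σ v) - (p + q) v = (p (σ v) - p v) + (q (σ v) - q v) := by
      simp only [Pi.add_apply]; abel
    rw [this]; exact add_mem (hp v) (hq v)
  smul_mem' := fun c p hp v => by
    have : (c • p) (σ v) - (c • p) v = c • (p (σ v) - p v) := by
      simp only [Pi.smul_apply, smul_sub]
    rw [this]; exact (A v).smul_mem c (hp v)

/-- The difference map along a permutation. -/
def cyclicDiff (σ : Equiv.Perm V) : (V → P) →ₗ[ℝ] (V → P) :=
  LinearMap.funLeft ℝ P σ - LinearMap.id

lemma cyclicDiff_apply (σ : Equiv.Perm V) (p : V → P) (v : V) :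
    cyclicDiff σ p v = p (σ v) - p v := rfl

/-- The sum of all entries of a tuple. -/
def tupleSum [Fintype V] : (V → P) →ₗ[ℝ] P := ∑ v, LinearMap.proj v

lemma tupleSum_apply [Fintype V] (p : V → P) : tupleSum p = ∑ v, p v := by
  simp [tupleSum]

variable [Nonempty V] {σ : Equiv.Perm V}

lemma finrank_ker_cyclicDiff (hσ : ∀ u w, ∃ k : ℕ, (σ ^ k) u = w) :
    finrank ℝ (LinearMap.ker (cyclicDiff (P := P) σ)) = finrank ℝ P := by
  let f : P →ₗ[ℝ] (V → P) := LinearMap.pi fun _ => LinearMap.id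
  have hf : Function.Injective f := fun a b h => congrFun h (Classical.arbitrary V)
  rw [← LinearMap.finrank_range_of_inj hf]
  suffices h : LinearMap.ker (cyclicDiff (P := P) σ) = LinearMap.range f by rw [h]
  ext p
  simp only [LinearMap.mem_ker, LinearMap.mem_range]
  constructor
  · intro h
    refine ⟨p (Classical.arbitrary V), funext fun w => ?_⟩
    obtain ⟨k, rfl⟩ := hσ (Classical.arbitrary V) w
    have h' : ∀ v, p (σ v) = p v := fun v => sub_eq_zero.1 (congrFun h v)
    have : ∀ k : ℕ, p ((σ ^ k) (Classical.arbitrary V)) = p (Classical.arbitrary V) := by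
      intro k
      induction k with
      | zero => simp
      | succ k ih => rw [pow_succ', Equiv.Perm.mul_apply, h', ih]
    exact (this k).symm
  · rintro ⟨a, rfl⟩
    funext v
    simp [cyclicDiff_apply, f]

variable [FiniteDimensional ℝ P] [Fintype V]

/-- Differences around the cycle sum to zero; equality is a count, because the kernel of the
difference map and the range of the sum both have the dimension of `P`. -/
lemma range_cyclicDiff (hσ : ∀ u w, ∃ k : ℕ, (σ ^ k) u = w) :
    LinearMap.range (cyclicDiff (P := P) σ) = LinearMap.ker (tupleSum (V := V) (P := P)) := by
  classical
  apply Submodule.eq_of_le_of_finrank_eq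
  · rintro _ ⟨p, rfl⟩
    rw [LinearMap.mem_ker, tupleSum_apply]
    simp only [cyclicDiff_apply, Finset.sum_sub_distrib]
    rw [Equiv.sum_comp σ p, sub_self]
  · have h1 := LinearMap.finrank_range_add_finrank_ker (cyclicDiff (P := P) σ)
    have h2 := LinearMap.finrank_range_add_finrank_ker (tupleSum (V := V) (P := P))
    have h3 : LinearMap.range (tupleSum (V := V) (P := P)) = ⊤ := by
      rw [LinearMap.range_eq_top]
      intro a
      exact ⟨Pi.single (Classical.arbitrary V) a, by simp [tupleSum_apply]⟩
    rw [h3, finrank_top] at h2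
    rw [finrank_ker_cyclicDiff hσ] at h1
    omega

/-- Rank-nullity is applied twice: to the difference map `D` on the space, with kernel the
constants, and to the summation map `S` on the product of the `A v`, with range their sum. The image
of `D` is the kernel of `S`. The additive form avoids truncated subtraction. -/
theorem finrank_cyclicSpace (hσ : ∀ u w, ∃ k : ℕ, (σ ^ k) u = w) (A : V → Submodule ℝ P) :
    finrank ℝ (cyclicSpace σ A) + finrank ℝ (⨆ v, A v : Submodule ℝ P) =
      finrank ℝ P + ∑ v, finrank ℝ (A v) := by
  classical
  let D := (cyclicDiff (P := P) σ).domRestrict (cyclicSpace σ A)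
  let i : (∀ v, A v) →ₗ[ℝ] (V → P) := LinearMap.pi fun v => (A v).subtype ∘ₗ LinearMap.proj v
  have hi : Function.Injective i := fun a b h => funext fun v => Subtype.ext (congrFun h v)
  let S := (tupleSum (V := V) (P := P)) ∘ₗ i
  have hk : finrank ℝ (LinearMap.ker D) = finrank ℝ P := by
    rw [← finrank_ker_cyclicDiff (P := P) hσ, LinearMap.ker_domRestrict]
    refine LinearEquiv.finrank_eq (Submodule.comapSubtypeEquivOfLe fun p hp v => ?_)
    rw [← cyclicDiff_apply, LinearMap.mem_ker.1 hp]
    exact zero_mem _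
  have hr : LinearMap.range D = (LinearMap.ker S).map i := by
    ext q
    simp only [LinearMap.mem_range, Submodule.mem_map, LinearMap.mem_ker]
    constructor
    · rintro ⟨p, rfl⟩
      refine ⟨fun v => ⟨p.1 (σ v) - p.1 v, p.2 v⟩, ?_, rfl⟩
      have : cyclicDiff σ p.1 ∈ LinearMap.ker (tupleSum (V := V) (P := P)) := by
        rw [← range_cyclicDiff hσ]; exact ⟨_, rfl⟩
      exact this
    · rintro ⟨a, ha, rfl⟩
      have : i a ∈ LinearMap.range (cyclicDiff (P := P) σ) := by
        rw [range_cyclicDiff hσ]; exact ha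
      obtain ⟨p, hp⟩ := this
      refine ⟨⟨p, fun v => ?_⟩, hp⟩
      rw [← cyclicDiff_apply, hp]
      exact (a v).2
  have hs : LinearMap.range S = ⨆ v, A v := by
    apply le_antisymm
    · rintro _ ⟨a, rfl⟩
      simp only [S, LinearMap.comp_apply, tupleSum_apply]
      exact Submodule.sum_mem _ fun v _ => Submodule.mem_iSup_of_mem v (a v).2
    · refine iSup_le fun v x hx => ⟨Pi.single v ⟨x, hx⟩, ?_⟩
      simp only [S, LinearMap.comp_apply, tupleSum_apply]
      rw [Finset.sum_eq_single v]
      · simp [i]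
      · intro w _ hw
        simp [i, hw]
      · simp
  have h1 := LinearMap.finrank_range_add_finrank_ker D
  have h2 := LinearMap.finrank_range_add_finrank_ker S
  rw [hr, ← (Submodule.equivMapOfInjective i hi _).finrank_eq, hk] at h1
  rw [hs, Module.finrank_pi_fintype] at h2
  omega

end Cyclic

/-! ### Linear forms of lines through `O` -/

/-- The Euclidean plane. -/
abbrev Plane := EuclideanSpace ℝ (Fin 2)

/-- The determinant of the pair `(v - O, w - O)`. -/
def cross (O v w : Plane) : ℝ :=
  (v 0 - O 0) * (w 1 - O 1) - (v 1 - O 1) * (w 0 - O 0)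

/-- The linear polynomial vanishing on the line through `O` and `v`. -/
def lineForm (O v : Plane) : MvPolynomial (Fin 2) ℝ :=
  C (v 0 - O 0) * (X 1 - C (O 1)) - C (v 1 - O 1) * (X 0 - C (O 0))

/-- The function on the plane defined by a polynomial. -/
def evalAt (p : MvPolynomial (Fin 2) ℝ) (x : Plane) : ℝ := eval (fun i => x i) p

lemma evalAt_add (p q : MvPolynomial (Fin 2) ℝ) (x : Plane) :
    evalAt (p + q) x = evalAt p x + evalAt q x := map_add _ _ _

lemma evalAt_sub (p q : MvPolynomial (Fin 2) ℝ) (x : Plane) :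
    evalAt (p - q) x = evalAt p x - evalAt q x := map_sub _ _ _

lemma evalAt_mul (p q : MvPolynomial (Fin 2) ℝ) (x : Plane) :
    evalAt (p * q) x = evalAt p x * evalAt q x := map_mul _ _ _

lemma evalAt_lineForm (O v x : Plane) : evalAt (lineForm O v) x = cross O v x := by
  simp [evalAt, lineForm, cross]

/-- Restriction of polynomials to the line through `O` and `v`, parametrized affinely. -/
def restrictLine (O v : Plane) : MvPolynomial (Fin 2) ℝ →ₐ[ℝ] Polynomial ℝ :=
  aeval fun i => Polynomial.C (O i) + Polynomial.C (v i - O i) * Polynomial.X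

lemma eval_restrictLine (O v : Plane) (p : MvPolynomial (Fin 2) ℝ) (s : ℝ) :
    (restrictLine O v p).eval s = evalAt p (O + s • (v - O)) := by
  have h : (Polynomial.evalRingHom s).comp (restrictLine O v).toRingHom =
      eval (fun i => (O + s • (v - O)) i) := by
    apply MvPolynomial.ringHom_ext
    · intro r
      simp [restrictLine]
    · intro i
      simp [restrictLine, mul_comm s]
  exact DFunLike.congr_fun h p

lemma plane_ne_iff (O v : Plane) : v ≠ O ↔ (v 0 - O 0) ^ 2 + (v 1 - O 1) ^ 2 ≠ 0 := by
  constructor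
  · intro h h0
    apply h
    have h1 : v 0 - O 0 = 0 := by nlinarith [sq_nonneg (v 0 - O 0), sq_nonneg (v 1 - O 1)]
    have h2 : v 1 - O 1 = 0 := by nlinarith [sq_nonneg (v 0 - O 0), sq_nonneg (v 1 - O 1)]
    ext i
    fin_cases i
    · exact sub_eq_zero.1 h1
    · exact sub_eq_zero.1 h2
  · rintro h rfl
    simp at h

/-- Modulo the linear form, each coordinate equals that of its projection to the line. Hence every
polynomial is congruent to its restriction to the line, evaluated at the parameter of the projected
point. -/
lemma lineForm_dvd_iff_restrictLine {O v : Plane} (hv : v ≠ O) (p : MvPolynomial (Fin 2) ℝ) :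
    lineForm O v ∣ p ↔ restrictLine O v p = 0 := by
  have hN := (plane_ne_iff O v).1 hv
  set N := (v 0 - O 0) ^ 2 + (v 1 - O 1) ^ 2 with hNdef
  have hl : restrictLine O v (lineForm O v) = 0 := by
    simp [restrictLine, lineForm]
    ring
  constructor
  · rintro ⟨q, rfl⟩
    rw [map_mul, hl, zero_mul]
  · intro hp
    -- `M` is the parameter, along the line, of the orthogonal projection of the generic point.
    let M : MvPolynomial (Fin 2) ℝ :=
      C ((v 0 - O 0) / N) * (X 0 - C (O 0)) + C ((v 1 - O 1) / N) * (X 1 - C (O 1))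
    let π := Ideal.Quotient.mkₐ ℝ (Ideal.span {lineForm O v})
    have hπ : (π.comp (Polynomial.aeval M)).comp (restrictLine O v) = π := by
      apply MvPolynomial.algHom_ext
      intro i
      simp only [AlgHom.comp_apply, restrictLine, aeval_X, map_add, map_mul, Polynomial.aeval_X,
        Polynomial.aeval_C, MvPolynomial.algebraMap_eq]
      rw [← map_mul, ← map_add]
      refine Ideal.Quotient.eq.2 (Ideal.mem_span_singleton.2 ?_)
      have h0 : C (v 0 - O 0) * C ((v 0 - O 0) / N) + C (v 1 - O 1) * C ((v 1 - O 1) / N)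
          = (1 : MvPolynomial (Fin 2) ℝ) := by
        rw [← C_mul, ← C_mul, ← C_add, ← C_1]
        congr 1
        field_simp
        exact hNdef.symm
      fin_cases i
      · refine ⟨C ((v 1 - O 1) / N), ?_⟩
        simp only [M, lineForm, Fin.zero_eta]
        linear_combination (X 0 - C (O 0)) * h0
      · refine ⟨-C ((v 0 - O 0) / N), ?_⟩
        simp only [M, lineForm, Fin.mk_one]
        linear_combination (X 1 - C (O 1)) * h0
    have h1 : π p = 0 := by
      rw [← hπ, AlgHom.comp_apply, hp, map_zero]
    exact Ideal.mem_span_singleton.1 (Ideal.Quotient.eq_zero_iff_mem.1 h1)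

lemma lineForm_ne_zero {O v : Plane} (hv : v ≠ O) : lineForm O v ≠ 0 := by
  intro h
  -- The test point is `v` turned by a right angle around `O`; the form takes the value `|v - O|²`
  -- there.
  have h1 := evalAt_lineForm O v (O + !₂[-(v 1 - O 1), v 0 - O 0])
  rw [h] at h1
  simp [evalAt, cross] at h1
  exact (plane_ne_iff O v).1 hv (by linear_combination -h1)

/-- The ideal it generates is the kernel of restriction to the line, a map into the domain `ℝ[X]`.
-/
lemma lineForm_prime {O v : Plane} (hv : v ≠ O) : Prime (lineForm O v) := by
  rw [← Ideal.span_singleton_prime (lineForm_ne_zero hv)]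
  have : Ideal.span {lineForm O v} = RingHom.ker (restrictLine O v).toRingHom := by
    ext p
    rw [Ideal.mem_span_singleton, lineForm_dvd_iff_restrictLine hv, RingHom.mem_ker]
    rfl
  rw [this]
  exact RingHom.ker_isPrime _

lemma lineForm_not_dvd_lineForm {O v w : Plane} (h : cross O v w ≠ 0) :
    ¬ lineForm O v ∣ lineForm O w := by
  rintro ⟨q, hq⟩
  have h1 := evalAt_lineForm O w v
  rw [hq, evalAt_mul, evalAt_lineForm] at h1
  unfold cross at h h1
  apply h
  linear_combination h1

lemma totalDegree_lineForm {O v : Plane} (hv : v ≠ O) : (lineForm O v).totalDegree = 1 := by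
  apply le_antisymm
  · unfold lineForm
    refine (totalDegree_sub _ _).trans (max_le ?_ ?_) <;>
    · refine (totalDegree_mul _ _).trans ?_
      rw [totalDegree_C, zero_add]
      refine (totalDegree_sub _ _).trans ?_
      simp
  · by_contra h
    have h0 : (lineForm O v).totalDegree = 0 := by omega
    have hu := (lineForm_prime hv).not_isUnit
    rw [totalDegree_eq_zero_iff_eq_C] at h0
    refine hu ?_
    rw [h0]
    refine (isUnit_iff_ne_zero.2 fun hc => lineForm_ne_zero hv ?_).map C
    rw [h0, hc, C_0]

lemma totalDegree_lineForm_sq {O v : Plane} (hv : v ≠ O) :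
    (lineForm O v ^ 2).totalDegree = 2 := by
  rw [sq, totalDegree_mul_of_isDomain (lineForm_ne_zero hv) (lineForm_ne_zero hv),
    totalDegree_lineForm hv]

/-! ### Multiples of squared linear forms, and sums of two such spaces -/

/-- The polynomials of degree at most `d` divisible by the square of the linear form of the
line through `O` and `v`. -/
def sqMultiples (O : Plane) (d : ℕ) (v : Plane) : Submodule ℝ (PolyDeg d) :=
  multiples (lineForm O v ^ 2) d

lemma mem_sqMultiples {O v : Plane} {d : ℕ} {p : PolyDeg d} :
    p ∈ sqMultiples O d v ↔ lineForm O v ^ 2 ∣ (p : MvPolynomial (Fin 2) ℝ) := mem_multiples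

lemma sqMultiples_eq_bot {O v : Plane} (hv : v ≠ O) {d : ℕ} (hd : d ≤ 1) :
    sqMultiples O d v = ⊥ :=
  multiples_eq_bot (by rw [totalDegree_lineForm_sq hv]; omega)

lemma finrank_sqMultiples {O v : Plane} (hv : v ≠ O) {d : ℕ} (hd : 2 ≤ d) :
    finrank ℝ (sqMultiples O d v) = numMonomials (d - 2) := by
  obtain ⟨e, rfl⟩ := Nat.exists_eq_add_of_le hd
  rw [Nat.add_sub_cancel_left]
  exact finrank_multiples e (pow_ne_zero _ (lineForm_ne_zero hv)) (totalDegree_lineForm_sq hv)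

lemma ne_of_cross_ne_left {O v w : Plane} (h : cross O v w ≠ 0) : v ≠ O := by
  rintro rfl; simp [cross] at h

lemma ne_of_cross_ne_right {O v w : Plane} (h : cross O v w ≠ 0) : w ≠ O := by
  rintro rfl; simp [cross] at h

/-- Forms of distinct lines are primes not dividing one another, so divisibility by both squares is
divisibility by their product. -/
lemma sqMultiples_inf {O v w : Plane} (h : cross O v w ≠ 0) (d : ℕ) :
    sqMultiples O d v ⊓ sqMultiples O d w =
      multiples (lineForm O v ^ 2 * lineForm O w ^ 2) d := by
  ext p
  rw [Submodule.mem_inf, mem_sqMultiples, mem_sqMultiples, mem_multiples]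
  constructor
  · rintro ⟨⟨q, hq⟩, h2⟩
    rw [hq] at h2 ⊢
    refine mul_dvd_mul_left _ ?_
    refine (lineForm_prime (ne_of_cross_ne_right h)).pow_dvd_of_dvd_mul_left 2 ?_ h2
    intro h3
    refine lineForm_not_dvd_lineForm (v := w) (w := v) ?_
      ((lineForm_prime (ne_of_cross_ne_right h)).dvd_of_dvd_pow h3)
    unfold cross at h ⊢
    exact fun h0 => h (by linear_combination -h0)
  · intro h
    exact ⟨(dvd_mul_right _ _).trans h, (dvd_mul_left _ _).trans h⟩

lemma totalDegree_sq_mul_sq {O v w : Plane} (h : cross O v w ≠ 0) :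
    (lineForm O v ^ 2 * lineForm O w ^ 2).totalDegree = 4 := by
  have hv := ne_of_cross_ne_left h
  have hw := ne_of_cross_ne_right h
  rw [totalDegree_mul_of_isDomain (pow_ne_zero _ (lineForm_ne_zero hv))
    (pow_ne_zero _ (lineForm_ne_zero hw)), totalDegree_lineForm_sq hv, totalDegree_lineForm_sq hw]

lemma finrank_sqMultiples_sup_of_le {O v w : Plane} (h : cross O v w ≠ 0) {d : ℕ} (hd : 2 ≤ d)
    (hd' : d ≤ 3) : finrank ℝ (sqMultiples O d v ⊔ sqMultiples O d w : Submodule ℝ (PolyDeg d)) =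
      2 * numMonomials (d - 2) := by
  have h1 := Submodule.finrank_sup_add_finrank_inf_eq (sqMultiples O d v) (sqMultiples O d w)
  rw [sqMultiples_inf h, multiples_eq_bot (by rw [totalDegree_sq_mul_sq h]; omega), finrank_bot,
    finrank_sqMultiples (ne_of_cross_ne_left h) hd,
    finrank_sqMultiples (ne_of_cross_ne_right h) hd] at h1
  omega

lemma finrank_sqMultiples_sup {O v w : Plane} (h : cross O v w ≠ 0) {d : ℕ} (hd : 4 ≤ d) :
    finrank ℝ (sqMultiples O d v ⊔ sqMultiples O d w : Submodule ℝ (PolyDeg d)) +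
      numMonomials (d - 4) = 2 * numMonomials (d - 2) := by
  have h1 := Submodule.finrank_sup_add_finrank_inf_eq (sqMultiples O d v) (sqMultiples O d w)
  rw [finrank_sqMultiples (ne_of_cross_ne_left h) (by omega),
    finrank_sqMultiples (ne_of_cross_ne_right h) (by omega), sqMultiples_inf h] at h1
  obtain ⟨e, rfl⟩ := Nat.exists_eq_add_of_le hd
  rw [finrank_multiples e (mul_ne_zero (pow_ne_zero _ (lineForm_ne_zero (ne_of_cross_ne_left h)))
    (pow_ne_zero _ (lineForm_ne_zero (ne_of_cross_ne_right h)))) (totalDegree_sq_mul_sq h)] at h1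
  rw [Nat.add_sub_cancel_left]
  omega

lemma sqMultiples_eq_of_cross_eq_zero {O v w : Plane} (hv : v ≠ O) (hw : w ≠ O)
    (h : cross O v w = 0) (d : ℕ) : sqMultiples O d v = sqMultiples O d w := by
  have key : ∀ v w : Plane, v ≠ O → cross O v w = 0 →
      sqMultiples O d w ≤ sqMultiples O d v := by
    intro v w hv h p hp
    rw [mem_sqMultiples] at hp ⊢
    refine (pow_dvd_pow_of_dvd ?_ 2).trans hp
    rw [lineForm_dvd_iff_restrictLine hv]
    apply Polynomial.funext
    intro s
    rw [eval_restrictLine, evalAt_lineForm]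
    simp only [cross, PiLp.add_apply, PiLp.smul_apply, PiLp.sub_apply, smul_eq_mul,
      Polynomial.eval_zero] at h ⊢
    linear_combination (-s) * h
  refine le_antisymm (key w v hw ?_) (key v w hv h)
  unfold cross at h ⊢
  linear_combination -h

/-! ### Three distinct lines: the sum is the kernel of the 1-jet at `O` -/

/-- Value and gradient at a point. -/
def oneJet (O : Plane) : MvPolynomial (Fin 2) ℝ →ₗ[ℝ] ℝ × (Fin 2 → ℝ) :=
  let e := (aeval (R := ℝ) fun i => O i).toLinearMap
  e.prod (LinearMap.pi fun i => e ∘ₗ (pderiv i).toLinearMap)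

lemma oneJet_eq_zero_iff {O : Plane} {p : MvPolynomial (Fin 2) ℝ} :
    oneJet O p = 0 ↔ evalAt p O = 0 ∧ ∀ i, evalAt (pderiv i p) O = 0 := by
  simp [oneJet, Prod.ext_iff, funext_iff, evalAt, aeval_eq_eval]

lemma oneJet_mul_eq_zero {O : Plane} {p q r : MvPolynomial (Fin 2) ℝ} (hp : evalAt p O = 0)
    (hq : evalAt q O = 0) : oneJet O (p * q * r) = 0 := by
  rw [oneJet_eq_zero_iff]
  refine ⟨by simp [evalAt_mul, hp], fun i => ?_⟩
  simp only [Derivation.leibniz, smul_eq_mul, evalAt_add, evalAt_mul, hp, hq]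
  ring

/-- Used twice, this gives a second-order expansion in the coordinates `a`, `b` with controlled
degrees of the cofactors. It suffices to treat monomials, splitting off one variable at a time. -/
lemma exists_eq_const_add {a b : MvPolynomial (Fin 2) ℝ}
    (hX : ∀ i, ∃ c α β : ℝ, X i = C c + C α * a + C β * b) (d : ℕ)
    (p : MvPolynomial (Fin 2) ℝ) (hp : p.totalDegree ≤ d + 1) :
    ∃ (c : ℝ) (q r : MvPolynomial (Fin 2) ℝ), q.totalDegree ≤ d ∧ r.totalDegree ≤ d ∧
      p = C c + a * q + b * r := by
  let S : Submodule ℝ (MvPolynomial (Fin 2) ℝ) :=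
    { carrier := {p | ∃ (c : ℝ) (q r : MvPolynomial (Fin 2) ℝ),
        q.totalDegree ≤ d ∧ r.totalDegree ≤ d ∧ p = C c + a * q + b * r}
      zero_mem' := ⟨0, 0, 0, by simp, by simp, by simp⟩
      add_mem' := by
        rintro _ _ ⟨c, q, r, hq, hr, rfl⟩ ⟨c', q', r', hq', hr', rfl⟩
        exact ⟨c + c', q + q', r + r', (totalDegree_add _ _).trans (max_le hq hq'),
          (totalDegree_add _ _).trans (max_le hr hr'), by rw [C_add]; ring⟩
      smul_mem' := by
        rintro t _ ⟨c, q, r, hq, hr, rfl⟩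
        refine ⟨t * c, t • q, t • r, (totalDegree_smul_le _ _).trans hq,
          (totalDegree_smul_le _ _).trans hr, ?_⟩
        rw [smul_eq_C_mul, smul_eq_C_mul, smul_eq_C_mul, C_mul]; ring }
  have hmon : ∀ e : ℕ, e ≤ d + 1 → ∀ s : Fin 2 →₀ ℕ, s.degree = e → monomial s (1 : ℝ) ∈ S := by
    intro e
    induction e with
    | zero =>
      intro _ s hs
      have : s = 0 := (Finsupp.degree_eq_zero_iff s).1 hs
      subst this
      exact ⟨1, 0, 0, by simp, by simp, by simp⟩
    | succ e ih =>
      intro he s hs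
      obtain ⟨i, hi⟩ : ∃ i, s i ≠ 0 := by
        by_contra! h
        have : s = 0 := Finsupp.ext h
        simp [this] at hs
      have hle : Finsupp.single i 1 ≤ s := by
        rw [Finsupp.single_le_iff]; omega
      obtain ⟨u, rfl⟩ := exists_add_of_le hle
      have hu : u.degree = e := by
        rw [map_add] at hs
        simp at hs
        omega
      have hmu : (monomial u (1 : ℝ)).totalDegree ≤ d := by
        rw [totalDegree_monomial _ one_ne_zero]
        change u.degree ≤ d
        omega
      obtain ⟨c, α, β, hc⟩ := hX i
      have hmono : monomial (Finsupp.single i 1 + u) (1 : ℝ) = X i * monomial u 1 := by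
        rw [X, monomial_mul, one_mul]
      have : monomial (Finsupp.single i 1 + u) (1 : ℝ) = c • monomial u (1 : ℝ) +
          (C 0 + a * (α • monomial u (1 : ℝ)) + b * (β • monomial u (1 : ℝ))) := by
        rw [hmono, hc, smul_eq_C_mul, smul_eq_C_mul, smul_eq_C_mul, C_0]
        ring
      rw [this]
      exact S.add_mem (S.smul_mem _ (ih (by omega) u hu))
        ⟨0, _, _, (totalDegree_smul_le _ _).trans hmu, (totalDegree_smul_le _ _).trans hmu, rfl⟩
  suffices h : p ∈ S from h
  rw [p.as_sum]
  refine S.sum_mem fun s hs => ?_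
  have : monomial s (coeff s p) = coeff s p • monomial s (1 : ℝ) := by
    rw [smul_monomial, smul_eq_mul, mul_one]
  rw [this]
  exact S.smul_mem _ (hmon _ ((le_totalDegree hs).trans hp) s rfl)

lemma X_eq_lineForm_combination {O v w : Plane} (h : cross O v w ≠ 0) (i : Fin 2) :
    X i = C (O i) + C ((w i - O i) / cross O v w) * lineForm O v +
      C (-(v i - O i) / cross O v w) * lineForm O w := by
  apply MvPolynomial.funext
  intro x
  have hx := evalAt_lineForm O v (WithLp.toLp 2 x)
  have hy := evalAt_lineForm O w (WithLp.toLp 2 x)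
  simp only [evalAt] at hx hy
  simp only [map_add, map_mul, eval_C, eval_X, hx, hy]
  field_simp
  unfold cross
  fin_cases i <;> simp <;> ring

lemma oneJet_combination {O v w : Plane} (h : cross O v w ≠ 0) {c c₁ c₂ : ℝ}
    (h0 : oneJet O (C c + C c₁ * lineForm O v + C c₂ * lineForm O w) = 0) :
    c = 0 ∧ c₁ = 0 ∧ c₂ = 0 := by
  rw [oneJet_eq_zero_iff] at h0
  obtain ⟨h1, h2⟩ := h0
  have e0 := h2 0
  have e1 := h2 1
  simp [lineForm, evalAt, pderiv_X] at h1 e0 e1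
  refine ⟨h1, ?_, ?_⟩
  · refine (mul_eq_zero.1 ?_).resolve_right h
    unfold cross
    linear_combination (w 1 - O 1) * e1 + (w 0 - O 0) * e0
  · refine (mul_eq_zero.1 ?_).resolve_right h
    unfold cross
    linear_combination -(v 1 - O 1) * e1 - (v 0 - O 0) * e0

/-- Three linear forms in the plane satisfy a linear relation, with the determinants as coefficients
(`key`). Squaring it and solving for the mixed product gives the constants. -/
lemma lineForm_mul_mem_span {O u v w : Plane} (huw : cross O u w ≠ 0)
    (hvw : cross O v w ≠ 0) : ∃ α β γ : ℝ, lineForm O u * lineForm O v =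
      C α * lineForm O u ^ 2 + C β * lineForm O v ^ 2 + C γ * lineForm O w ^ 2 := by
  refine ⟨cross O v w / (2 * cross O u w), cross O u w / (2 * cross O v w),
    -(cross O u v) ^ 2 / (2 * cross O v w * cross O u w), ?_⟩
  apply MvPolynomial.funext
  intro x
  have hx := evalAt_lineForm O u (WithLp.toLp 2 x)
  have hy := evalAt_lineForm O v (WithLp.toLp 2 x)
  have hz := evalAt_lineForm O w (WithLp.toLp 2 x)
  simp only [evalAt] at hx hy hz
  simp only [map_add, map_mul, map_pow, eval_C, hx, hy, hz]
  have key : cross O u v * cross O w (WithLp.toLp 2 x) =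
      cross O u w * cross O v (WithLp.toLp 2 x) - cross O v w * cross O u (WithLp.toLp 2 x) := by
    unfold cross
    ring
  generalize cross O u (WithLp.toLp 2 x) = a at *
  generalize cross O v (WithLp.toLp 2 x) = b at *
  generalize cross O w (WithLp.toLp 2 x) = c at *
  have : -(cross O u v) ^ 2 / (2 * cross O v w * cross O u w) * c ^ 2 =
      -(cross O u v * c) ^ 2 / (2 * cross O v w * cross O u w) := by ring
  rw [this, key]
  field_simp
  ring

lemma iSup_sqMultiples_eq {V : Type*} {f : V → Plane} {O : Plane} {u v w : V}
    (hf : ∀ x, f x ≠ O)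
    (huv : cross O (f u) (f v) ≠ 0) (huw : cross O (f u) (f w) ≠ 0)
    (hvw : cross O (f v) (f w) ≠ 0) {d : ℕ} (hd : 2 ≤ d) :
    (⨆ x, sqMultiples O d (f x) : Submodule ℝ (PolyDeg d)) =
      LinearMap.ker ((oneJet O).comp (PolyDeg d).subtype) := by
  have hself : ∀ x, evalAt (lineForm O x) O = 0 := fun x => by
    rw [evalAt_lineForm]; simp [cross]
  apply le_antisymm
  · refine iSup_le fun x p hp => ?_
    obtain ⟨q, hq⟩ := mem_sqMultiples.1 hp
    rw [LinearMap.mem_ker, LinearMap.comp_apply, Submodule.subtype_apply, hq, sq]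
    exact oneJet_mul_eq_zero (hself _) (hself _)
  · intro p hp
    obtain ⟨e, rfl⟩ : ∃ e, d = e + 1 + 1 := ⟨d - 2, by omega⟩
    have hX : ∀ i, ∃ c α β : ℝ, X i = C c + C α * lineForm O (f u) + C β * lineForm O (f v) :=
      fun i => ⟨_, _, _, X_eq_lineForm_combination huv i⟩
    obtain ⟨c, q, r, hq, hr, hpe⟩ :=
      exists_eq_const_add hX (e + 1) p ((mem_restrictTotalDegree _ _ _).1 p.2)
    obtain ⟨c₁, q₁, r₁, hq₁, hr₁, rfl⟩ := exists_eq_const_add hX e q hq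
    obtain ⟨c₂, q₂, r₂, hq₂, hr₂, rfl⟩ := exists_eq_const_add hX e r hr
    set a := lineForm O (f u) with ha
    set b := lineForm O (f v) with hb
    -- The quadratic terms have zero 1-jet at `O`, so `hp` forces the affine part to vanish. The
    -- mixed term `a * b` is then absorbed into the three squares without raising the degree.
    have hpe' : (p : MvPolynomial (Fin 2) ℝ) =
        (C c + C c₁ * a + C c₂ * b) + a * a * q₁ + a * b * (r₁ + q₂) + b * b * r₂ := by
      rw [hpe]; ring
    rw [LinearMap.mem_ker, LinearMap.comp_apply, Submodule.subtype_apply, hpe', map_add, map_add,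
      map_add, oneJet_mul_eq_zero (hself _) (hself _), oneJet_mul_eq_zero (hself _) (hself _),
      oneJet_mul_eq_zero (hself _) (hself _), add_zero, add_zero, add_zero] at hp
    obtain ⟨rfl, rfl, rfl⟩ := oneJet_combination huv hp
    obtain ⟨α, β, γ, habc⟩ := lineForm_mul_mem_span huw hvw
    have hmem : ∀ (x : V) (s : MvPolynomial (Fin 2) ℝ), s.totalDegree ≤ e →
        lineForm O (f x) ^ 2 * s ∈ (⨆ x, sqMultiples O (e + 1 + 1) (f x) :
          Submodule ℝ (PolyDeg (e + 1 + 1))).map (PolyDeg (e + 1 + 1)).subtype := by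
      intro x s hs
      refine ⟨⟨lineForm O (f x) ^ 2 * s, ?_⟩, Submodule.mem_iSup_of_mem x ?_, rfl⟩
      · rw [mem_restrictTotalDegree]
        refine (totalDegree_mul _ _).trans ?_
        rw [totalDegree_lineForm_sq (hf x)]
        omega
      · rw [mem_sqMultiples]
        exact dvd_mul_right _ _
    have hdeg : ∀ t : ℝ, (C t * (r₁ + q₂)).totalDegree ≤ e := fun t => by
      rw [← smul_eq_C_mul]
      exact (totalDegree_smul_le _ _).trans ((totalDegree_add _ _).trans (max_le hr₁ hq₂))
    have hfin : (p : MvPolynomial (Fin 2) ℝ) = lineForm O (f u) ^ 2 * (q₁ + C α * (r₁ + q₂)) +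
        lineForm O (f v) ^ 2 * (r₂ + C β * (r₁ + q₂)) +
        lineForm O (f w) ^ 2 * (C γ * (r₁ + q₂)) := by
      rw [hpe', ha, hb]
      rw [← ha, ← hb] at habc ⊢
      rw [habc, C_0]
      ring
    have : (p : MvPolynomial (Fin 2) ℝ) ∈ (⨆ x, sqMultiples O (e + 1 + 1) (f x) :
          Submodule ℝ (PolyDeg (e + 1 + 1))).map (PolyDeg (e + 1 + 1)).subtype := by
      rw [hfin]
      exact add_mem (add_mem
        (hmem _ _ ((totalDegree_add _ _).trans (max_le hq₁ (hdeg α))))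
        (hmem _ _ ((totalDegree_add _ _).trans (max_le hr₂ (hdeg β)))))
        (hmem _ _ (hdeg γ))
    obtain ⟨p', hp', he⟩ := this
    rwa [← Subtype.ext he]

/-- Affine polynomials already realise every value and gradient, three parameters in all. -/
lemma finrank_ker_oneJet (O : Plane) {d : ℕ} (hd : 1 ≤ d) :
    finrank ℝ (LinearMap.ker ((oneJet O).comp (PolyDeg d).subtype)) + 3 = numMonomials d := by
  have h := LinearMap.finrank_range_add_finrank_ker ((oneJet O).comp (PolyDeg d).subtype)
  have hr : LinearMap.range ((oneJet O).comp (PolyDeg d).subtype) = ⊤ := by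
    rw [LinearMap.range_eq_top]
    rintro ⟨c, g⟩
    refine ⟨⟨C c + C (g 0) * (X 0 - C (O 0)) + C (g 1) * (X 1 - C (O 1)), ?_⟩, ?_⟩
    · rw [mem_restrictTotalDegree]
      have h1 : ∀ (i : Fin 2) (t : ℝ), (C t * (X i - C (O i))).totalDegree ≤ d := fun i t => by
        refine (totalDegree_mul _ _).trans ?_
        rw [totalDegree_C, zero_add]
        refine (totalDegree_sub _ _).trans ?_
        simpa using hd
      refine (totalDegree_add _ _).trans (max_le ((totalDegree_add _ _).trans
        (max_le ?_ (h1 _ _))) (h1 _ _))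
      simp
    · simp only [LinearMap.comp_apply, Submodule.subtype_apply]
      refine Prod.ext ?_ (funext fun i => ?_)
      · simp [oneJet, aeval_eq_eval]
      · fin_cases i <;> simp [oneJet, aeval_eq_eval, pderiv_X]
  rw [hr, finrank_top, finrank_polyDeg] at h
  simp at h
  omega

/-! ### Determinants, cones and triangles at `O` -/

section Cross

variable {O v w x y : Plane}

lemma cross_swap (O v w : Plane) : cross O w v = -cross O v w := by
  unfold cross; ring

lemma cross_diag (O v : Plane) : cross O v v = 0 := by
  unfold cross; ring

lemma cross_center (O v : Plane) : cross O v O = 0 := by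
  simp [cross]

lemma cross_smul_right (O v y : Plane) (s : ℝ) :
    cross O v (O + s • (y - O)) = s * cross O v y := by
  simp [cross]; ring

lemma cross_smul_left (O v y : Plane) (s : ℝ) :
    cross O (O + s • (y - O)) v = s * cross O y v := by
  simp [cross]; ring

lemma continuous_cross_right (O v : Plane) : Continuous fun x => cross O v x := by
  unfold cross; fun_prop

lemma continuous_cross_left (O v : Plane) : Continuous fun x => cross O x v := by
  unfold cross; fun_prop

lemma eq_add_of_cross_ne_zero (h : cross O v w ≠ 0) (x : Plane) :
    x = O + (cross O x w / cross O v w) • (v - O) + (cross O v x / cross O v w) • (w - O) := by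
  ext i
  simp only [PiLp.add_apply, PiLp.smul_apply, PiLp.sub_apply, smul_eq_mul]
  rw [← sub_eq_zero]
  field_simp
  unfold cross
  fin_cases i <;> simp <;> ring

lemma eq_center_of_cross_eq_zero (h : cross O v w ≠ 0) (h1 : cross O v x = 0)
    (h2 : cross O x w = 0) : x = O := by
  rw [eq_add_of_cross_ne_zero h x, h1, h2]
  simp

lemma exists_smul_of_cross_eq_zero (hv : v ≠ O) (h : cross O v w = 0) :
    ∃ r : ℝ, w = O + r • (v - O) := by
  have hN := (plane_ne_iff O v).1 hv
  refine ⟨((v 0 - O 0) * (w 0 - O 0) + (v 1 - O 1) * (w 1 - O 1)) /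
    ((v 0 - O 0) ^ 2 + (v 1 - O 1) ^ 2), ?_⟩
  unfold cross at h
  ext i
  simp only [PiLp.add_apply, PiLp.smul_apply, PiLp.sub_apply, smul_eq_mul]
  rw [← sub_eq_zero]
  field_simp
  fin_cases i
  · simp only [Fin.zero_eta]
    linear_combination -(v 1 - O 1) * h
  · simp only [Fin.mk_one]
    linear_combination (v 0 - O 0) * h

/-- Divided by `cross O v w`, the two determinants are the barycentric coordinates of `x` at `w` and
`v`. -/
lemma mem_triangle_iff (h : 0 < cross O v w) : x ∈ convexHull ℝ ({O, v, w} : Set Plane) ↔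
    0 ≤ cross O v x ∧ 0 ≤ cross O x w ∧ cross O v x + cross O x w ≤ cross O v w := by
  constructor
  · intro hx
    rw [convexHull_insert (by simp), convexHull_pair, mem_convexJoin] at hx
    obtain ⟨o, ho, y, ⟨a, b, ha, hb, hab, rfl⟩, c, e, hc, he, hce, rfl⟩ := hx
    rw [Set.mem_singleton_iff.1 ho]
    obtain rfl : b = 1 - a := by linarith
    obtain rfl : c = 1 - e := by linarith
    have h1 : cross O v ((1 - e) • O + e • (a • v + (1 - a) • w)) =
        e * (1 - a) * cross O v w := by
      simp [cross]; ring
    have h2 : cross O ((1 - e) • O + e • (a • v + (1 - a) • w)) w = e * a * cross O v w := by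
      simp [cross]; ring
    rw [h1, h2]
    refine ⟨by positivity, by positivity, ?_⟩
    nlinarith
  · rintro ⟨h1, h2, h3⟩
    have hx := eq_add_of_cross_ne_zero h.ne' x
    set β := cross O v x / cross O v w
    set α := cross O x w / cross O v w
    have hα : 0 ≤ α := by positivity
    have hβ : 0 ≤ β := by positivity
    have hαβ : α + β ≤ 1 := by
      rw [← add_div, div_le_one h]; linarith
    have := (convex_convexHull ℝ ({O, v, w} : Set Plane)).sum_mem (t := Finset.univ)
      (w := ![1 - α - β, α, β]) (z := ![O, v, w]) (by
        intro i _; fin_cases i <;> simp <;> linarith) (by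
        simp [Fin.sum_univ_three]; ring) (by
        intro i _; apply subset_convexHull; fin_cases i <;> simp)
    convert this using 1
    rw [hx]
    simp only [Fin.sum_univ_three, Matrix.cons_val_zero, Matrix.cons_val_one, Matrix.cons_val]
    module

lemma exists_smul_of_mem_segment {O v x : Plane} (h : x ∈ convexHull ℝ ({O, v} : Set Plane)) :
    ∃ s : ℝ, x = O + s • (v - O) := by
  rw [convexHull_pair] at h
  obtain ⟨a, b, _, _, hab, rfl⟩ := h
  obtain rfl : a = 1 - b := by linarith
  exact ⟨b, by module⟩

lemma cross_eq_zero_of_mem_segment (h : x ∈ convexHull ℝ ({O, v} : Set Plane)) :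
    cross O v x = 0 := by
  obtain ⟨s, rfl⟩ := exists_smul_of_mem_segment h
  rw [cross_smul_right, cross_diag, mul_zero]

lemma cone_subset_scaled_triangle (h : 0 < cross O v w) (h1 : 0 ≤ cross O v y)
    (h2 : 0 ≤ cross O y w) : ∃ s₀ > 0, ∀ s : ℝ, 0 ≤ s → s ≤ s₀ →
      O + s • (y - O) ∈ convexHull ℝ ({O, v, w} : Set Plane) := by
  -- The summand 1 keeps the denominator positive when `y = O`.
  refine ⟨cross O v w / (cross O v y + cross O y w + 1), by positivity, fun s hs hs' => ?_⟩
  rw [mem_triangle_iff h, cross_smul_right, cross_smul_left]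
  refine ⟨by positivity, by positivity, ?_⟩
  rw [le_div_iff₀ (by positivity)] at hs'
  nlinarith

end Cross

/-! ### How triangles and edges at `O` can meet -/

section Link

open scoped Classical

variable {Δ : SimplicialComplex ℝ Plane} {O v w a b x y : Plane}

/-- The vertices of `Δ` joined to `O` by an edge. -/
def linkVertices (Δ : SimplicialComplex ℝ Plane) (O : Plane) : Set Plane :=
  {v | v ≠ O ∧ ({O, v} : Finset Plane) ∈ Δ.faces}

/-- `O`, `v`, `w` span a triangle of `Δ`, in counterclockwise order. -/
def IsNext (Δ : SimplicialComplex ℝ Plane) (O v w : Plane) : Prop :=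
  ({O, v, w} : Finset Plane) ∈ Δ.faces ∧ 0 < cross O v w

lemma IsNext.ne_left (h : IsNext Δ O v w) : v ≠ O := ne_of_cross_ne_left h.2.ne'

lemma IsNext.ne_right (h : IsNext Δ O v w) : w ≠ O := ne_of_cross_ne_right h.2.ne'

lemma IsNext.ne (h : IsNext Δ O v w) : v ≠ w := by
  rintro rfl; exact h.2.ne' (cross_diag _ _)

lemma IsNext.left_mem (h : IsNext Δ O v w) : v ∈ linkVertices Δ O :=
  ⟨h.ne_left, Δ.down_closed h.1 (by intro z; simp; tauto) (by simp)⟩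

lemma IsNext.right_mem (h : IsNext Δ O v w) : w ∈ linkVertices Δ O :=
  ⟨h.ne_right, Δ.down_closed h.1 (by intro z; simp; tauto) (by simp)⟩

lemma IsNext.mem_topSimplices (h : IsNext Δ O v w) :
    ({O, v, w} : Finset Plane) ∈ topSimplices Δ :=
  ⟨h.1, Finset.card_eq_three.2 ⟨O, v, w, h.ne_left.symm, h.ne_right.symm, h.ne, rfl⟩⟩

lemma IsNext.hull_inter (h : IsNext Δ O v w) (h' : IsNext Δ O a b)
    (hx : x ∈ convexHull ℝ ({O, v, w} : Set Plane))
    (hx' : x ∈ convexHull ℝ ({O, a, b} : Set Plane)) :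
    x ∈ convexHull ℝ (({O, v, w} : Set Plane) ∩ {O, a, b}) := by
  have := Δ.inter_subset_convexHull h.1 h'.1 (a := x)
  simp only [Finset.coe_insert, Finset.coe_singleton] at this
  exact this ⟨hx, hx'⟩

lemma IsNext.cross_eq_zero_of_left_notMem (h : IsNext Δ O v w) (h' : IsNext Δ O a b)
    (hx : x ∈ convexHull ℝ ({O, v, w} : Set Plane))
    (hx' : x ∈ convexHull ℝ ({O, a, b} : Set Plane)) (hv : v ≠ a ∧ v ≠ b) :
    cross O x w = 0 := by
  have hsub : ({O, v, w} : Set Plane) ∩ {O, a, b} ⊆ {O, w} := by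
    rintro z ⟨hz, hz'⟩
    have := h.ne_left
    simp only [Set.mem_insert_iff, Set.mem_singleton_iff] at hz hz' ⊢
    grind
  have := cross_eq_zero_of_mem_segment (convexHull_mono hsub (h.hull_inter h' hx hx'))
  rw [cross_swap, this, neg_zero]

lemma IsNext.cross_eq_zero_of_right_notMem (h : IsNext Δ O v w) (h' : IsNext Δ O a b)
    (hx : x ∈ convexHull ℝ ({O, v, w} : Set Plane))
    (hx' : x ∈ convexHull ℝ ({O, a, b} : Set Plane)) (hw : w ≠ a ∧ w ≠ b) :
    cross O v x = 0 := by
  have hsub : ({O, v, w} : Set Plane) ∩ {O, a, b} ⊆ {O, v} := by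
    rintro z ⟨hz, hz'⟩
    have := h.ne_right
    simp only [Set.mem_insert_iff, Set.mem_singleton_iff] at hz hz' ⊢
    grind
  exact cross_eq_zero_of_mem_segment (convexHull_mono hsub (h.hull_inter h' hx hx'))

lemma IsNext.eq_of_mem (h : IsNext Δ O v w) (h' : IsNext Δ O a b)
    (hv : v = a ∨ v = b) (hw : w = a ∨ w = b) : v = a ∧ w = b := by
  have h1 := h.2
  have h2 := h'.2
  have h3 := h.ne
  rcases hv with rfl | rfl
  · exact ⟨rfl, hw.resolve_left h3.symm⟩
  · rcases hw with rfl | rfl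
    · rw [cross_swap] at h2
      linarith
    · exact absurd rfl h3

/-- Two triangles at `O` are equal, or share at most the vertex `O`, or an edge containing it. -/
lemma IsNext.inter_cases (h : IsNext Δ O v w) (h' : IsNext Δ O a b)
    (hx : x ∈ convexHull ℝ ({O, v, w} : Set Plane))
    (hx' : x ∈ convexHull ℝ ({O, a, b} : Set Plane)) :
    x = O ∨ (v = a ∧ w = b) ∨ ((v = a ∨ v = b) ∧ cross O v x = 0) ∨
      ((w = a ∨ w = b) ∧ cross O w x = 0) := by
  by_cases hv : v = a ∨ v = b
  · by_cases hw : w = a ∨ w = b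
    · exact Or.inr (Or.inl (h.eq_of_mem h' hv hw))
    · exact Or.inr (Or.inr (Or.inl
        ⟨hv, h.cross_eq_zero_of_right_notMem h' hx hx' (not_or.1 hw)⟩))
  · have h1 := h.cross_eq_zero_of_left_notMem h' hx hx' (not_or.1 hv)
    by_cases hw : w = a ∨ w = b
    · exact Or.inr (Or.inr (Or.inr ⟨hw, by rw [cross_swap, h1, neg_zero]⟩))
    · exact Or.inl (eq_center_of_cross_eq_zero h.2.ne'
        (h.cross_eq_zero_of_right_notMem h' hx hx' (not_or.1 hw)) h1)

lemma IsNext.exists_scaled_mem (h : IsNext Δ O v w) (h' : IsNext Δ O a b)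
    (h1 : 0 ≤ cross O v y) (h2 : 0 ≤ cross O y w) (h3 : 0 ≤ cross O a y) (h4 : 0 ≤ cross O y b) :
    ∃ s : ℝ, s > 0 ∧ O + s • (y - O) ∈ convexHull ℝ ({O, v, w} : Set Plane) ∧
      O + s • (y - O) ∈ convexHull ℝ ({O, a, b} : Set Plane) := by
  obtain ⟨s₁, hs₁, H₁⟩ := cone_subset_scaled_triangle h.2 h1 h2
  obtain ⟨s₂, hs₂, H₂⟩ := cone_subset_scaled_triangle h'.2 h3 h4
  exact ⟨min s₁ s₂, lt_min hs₁ hs₂, H₁ _ (lt_min hs₁ hs₂).le (min_le_left _ _),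
    H₂ _ (lt_min hs₁ hs₂).le (min_le_right _ _)⟩

/-- Shrinking `y` towards `O` gives a point common to both triangles and off the two edges of the
first at `O`, which leaves only the case of equal triangles. -/
lemma IsNext.eq_of_overlap (h : IsNext Δ O v w) (h' : IsNext Δ O a b)
    (h1 : 0 < cross O v y) (h2 : 0 < cross O y w) (h3 : 0 ≤ cross O a y) (h4 : 0 ≤ cross O y b) :
    v = a ∧ w = b := by
  obtain ⟨s, hs, hx, hx'⟩ := h.exists_scaled_mem h' h1.le h2.le h3 h4
  rcases h.inter_cases h' hx hx' with h0 | h0 | ⟨-, h0⟩ | ⟨-, h0⟩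
  · have := cross_smul_right O v y s
    rw [h0, cross_center] at this
    have : 0 < s * cross O v y := by positivity
    linarith
  · exact h0
  · rw [cross_smul_right] at h0
    have : 0 < s * cross O v y := by positivity
    linarith
  · rw [cross_smul_right, cross_swap] at h0
    have : 0 < s * cross O y w := by positivity
    linarith

lemma exists_pos_add_mul_pos {p : ℝ} (hp : 0 < p) (q : ℝ) : ∃ ε > 0, 0 < p + ε * q := by
  refine ⟨p / (|q| + 1), by positivity, ?_⟩
  have h1 : -|q| ≤ q := neg_abs_le q
  have h2 : p + p / (|q| + 1) * q = p * (|q| + 1 + q) / (|q| + 1) := by field_simp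
  rw [h2]
  have : 0 < |q| + 1 + q := by linarith
  positivity

lemma IsNext.right_unique (h : IsNext Δ O v w) (h' : IsNext Δ O v b) : w = b := by
  obtain ⟨ε, hε, hpos⟩ := exists_pos_add_mul_pos h.2 (cross O b w)
  have hb := h'.2
  -- This direction is `v` turned slightly counterclockwise, hence inside both cones.
  refine (h.eq_of_overlap (y := v + ε • (b - O)) h' ?_ ?_ ?_ ?_).2
  · have : cross O v (v + ε • (b - O)) = ε * cross O v b := by simp [cross]; ring
    rw [this]; positivity
  · have : cross O (v + ε • (b - O)) w = cross O v w + ε * cross O b w := by simp [cross]; ring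
    rwa [this]
  · have : cross O v (v + ε • (b - O)) = ε * cross O v b := by simp [cross]; ring
    rw [this]; positivity
  · have : cross O (v + ε • (b - O)) b = cross O v b := by simp [cross]; ring
    rw [this]; exact hb.le

lemma IsNext.left_unique (h : IsNext Δ O v w) (h' : IsNext Δ O a w) : v = a := by
  obtain ⟨ε, hε, hpos⟩ := exists_pos_add_mul_pos h.2 (cross O v a)
  have hb := h'.2
  refine (h.eq_of_overlap (y := w + ε • (a - O)) h' ?_ ?_ ?_ ?_).1
  · have : cross O v (w + ε • (a - O)) = cross O v w + ε * cross O v a := by simp [cross]; ring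
    rwa [this]
  · have : cross O (w + ε • (a - O)) w = ε * cross O a w := by simp [cross]; ring
    rw [this]; positivity
  · have : cross O a (w + ε • (a - O)) = cross O a w := by simp [cross]; ring
    rw [this]; exact hb.le
  · have : cross O (w + ε • (a - O)) w = ε * cross O a w := by simp [cross]; ring
    rw [this]; positivity

/-- Two different edges on one ray would share points other than `O`. -/
lemma linkVertex_eq_of_pos_smul (hv : v ∈ linkVertices Δ O) (hw : w ∈ linkVertices Δ O) {r : ℝ}
    (hr : 0 < r) (h : w = O + r • (v - O)) : v = w := by
  by_contra hne
  obtain ⟨s, hs, hs1, hsr⟩ : ∃ s : ℝ, 0 < s ∧ s ≤ 1 ∧ s ≤ r :=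
    ⟨min 1 r, lt_min one_pos hr, min_le_left _ _, min_le_right _ _⟩
  have h1 : O + s • (v - O) ∈ convexHull ℝ ({O, v} : Set Plane) := by
    rw [convexHull_pair]
    exact ⟨1 - s, s, by linarith, hs.le, by ring, by module⟩
  have h2 : O + s • (v - O) ∈ convexHull ℝ ({O, w} : Set Plane) := by
    rw [convexHull_pair]
    refine ⟨1 - s / r, s / r, ?_, by positivity, by ring, ?_⟩
    · rw [sub_nonneg, div_le_one hr]; exact hsr
    · rw [h]
      have : s = s / r * r := by field_simp
      nth_rewrite 3 [this]
      module
  have h3 := Δ.inter_subset_convexHull hv.2 hw.2 (a := O + s • (v - O))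
  simp only [Finset.coe_insert, Finset.coe_singleton] at h3
  have h4 := h3 ⟨h1, h2⟩
  have hsub : ({O, v} : Set Plane) ∩ {O, w} ⊆ {O} := by
    rintro z ⟨hz, hz'⟩
    have := hv.1
    simp only [Set.mem_insert_iff, Set.mem_singleton_iff] at hz hz' ⊢
    grind
  have h5 := convexHull_mono hsub h4
  rw [convexHull_singleton, Set.mem_singleton_iff, add_eq_left, smul_eq_zero] at h5
  exact h5.elim hs.ne' (sub_ne_zero.2 hv.1)

lemma exists_isNext_of_topSimplices {t : Finset Plane} (ht : t ∈ topSimplices Δ) (hO : O ∈ t) :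
    ∃ v w, IsNext Δ O v w ∧ t = {O, v, w} := by
  have hc : (t.erase O).card = 2 := by rw [Finset.card_erase_of_mem hO, ht.2]
  obtain ⟨a, b, hab, he⟩ := Finset.card_eq_two.1 hc
  have hte : t = {O, a, b} := by rw [← Finset.insert_erase hO, he]
  have ha : a ∈ t.erase O := by simp [he]
  have hb : b ∈ t.erase O := by simp [he]
  have haO := Finset.ne_of_mem_erase ha
  have hbO := Finset.ne_of_mem_erase hb
  have hne : cross O a b ≠ 0 := by
    intro h0
    let f : Fin 3 → t := ![⟨O, hO⟩, ⟨a, Finset.mem_of_mem_erase ha⟩,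
      ⟨b, Finset.mem_of_mem_erase hb⟩]
    have hf : Function.Injective f := by
      intro i j hij
      have := congrArg Subtype.val hij
      fin_cases i <;> fin_cases j <;> simp_all [f]
    have h1 := (Δ.indep ht.1).comp_embedding ⟨f, hf⟩
    have h2 : (fun z : t => (z : Plane)) ∘ f = ![O, a, b] := by
      funext i; fin_cases i <;> rfl
    change AffineIndependent ℝ ((fun z : t => (z : Plane)) ∘ f) at h1
    rw [h2, affineIndependent_iff_not_collinear_set] at h1
    apply h1
    rw [collinear_iff_of_mem (p₀ := O) (by simp)]
    obtain ⟨r, hr⟩ := exists_smul_of_cross_eq_zero haO h0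
    refine ⟨a - O, fun p hp => ?_⟩
    rcases hp with rfl | rfl | rfl
    · exact ⟨0, by simp⟩
    · exact ⟨1, by simp⟩
    · exact ⟨r, by rw [vadd_eq_add, add_comm]; exact hr⟩
  rcases lt_or_gt_of_ne hne with h | h
  · refine ⟨b, a, ⟨?_, by rw [cross_swap]; linarith⟩, ?_⟩
    · rw [Finset.pair_comm, ← hte]; exact ht.1
    · rw [Finset.pair_comm]; exact hte
  · exact ⟨a, b, ⟨hte ▸ ht.1, h⟩, hte⟩

end Link

/-! ### The rotation around the center, and singular vertices -/

section Pinwheel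

open scoped Classical Topology

variable {Δ : SimplicialComplex ℝ Plane} {O v w a b x y : Plane}

lemma IsNext.hull_subset_space (h : IsNext Δ O v w) :
    convexHull ℝ ({O, v, w} : Set Plane) ⊆ Δ.space := by
  have := Δ.convexHull_subset_space h.1
  simpa only [Finset.coe_insert, Finset.coe_singleton] using this

namespace IsPinwheel

lemma center_mem_of_topSimplices (hΔ : IsPinwheel Δ O) {t : Finset Plane}
    (ht : t ∈ topSimplices Δ) : O ∈ t := by
  obtain ⟨t', ht', hsub, hO⟩ := hΔ.radiate t ht.1
  rwa [Finset.eq_of_subset_of_card_le hsub (by rw [ht.2, ht'.2])]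

lemma topSimplices_finite (hΔ : IsPinwheel Δ O) : (topSimplices Δ).Finite :=
  hΔ.finite.subset fun _ ht => ht.1

lemma exists_isNext_of_mem_space (hΔ : IsPinwheel Δ O) (hx : x ∈ Δ.space) :
    ∃ v w, IsNext Δ O v w ∧ x ∈ convexHull ℝ ({O, v, w} : Set Plane) := by
  obtain ⟨s, hs, hxs⟩ := SimplicialComplex.mem_space_iff.1 hx
  obtain ⟨t, ht, hst, hO⟩ := hΔ.radiate s hs
  obtain ⟨v, w, h, rfl⟩ := exists_isNext_of_topSimplices ht hO
  refine ⟨v, w, h, ?_⟩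
  have := convexHull_mono (𝕜 := ℝ) (Finset.coe_subset.2 hst) hxs
  simpa only [Finset.coe_insert, Finset.coe_singleton] using this

lemma exists_scaled_mem_interior (hΔ : IsPinwheel Δ O) (y : Plane) :
    ∃ s : ℝ, 0 < s ∧ s ≤ 1 ∧ O + s • (y - O) ∈ interior Δ.space := by
  have hc : Filter.Tendsto (fun s : ℝ => O + s • (y - O)) (𝓝[>] 0) (𝓝 O) := by
    have : Continuous fun s : ℝ => O + s • (y - O) := by fun_prop
    have h := this.tendsto 0
    simp only [zero_smul, add_zero] at h
    exact h.mono_left nhdsWithin_le_nhds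
  have h1 := hc.eventually (isOpen_interior.mem_nhds hΔ.center_interior)
  have h2 : ∀ᶠ s : ℝ in 𝓝[>] 0, s ∈ Set.Ioc (0 : ℝ) 1 := Ioc_mem_nhdsGT one_pos
  obtain ⟨s, hs, hs'⟩ := (h1.and h2).exists
  exact ⟨s, hs'.1, hs'.2, hs⟩

lemma exists_cone (hΔ : IsPinwheel Δ O) (y : Plane) :
    ∃ v w, IsNext Δ O v w ∧ 0 ≤ cross O v y ∧ 0 ≤ cross O y w := by
  obtain ⟨s, hs, -, hmem⟩ := hΔ.exists_scaled_mem_interior y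
  obtain ⟨v, w, h, hx⟩ := hΔ.exists_isNext_of_mem_space (interior_subset hmem)
  rw [mem_triangle_iff h.2, cross_smul_right, cross_smul_left] at hx
  exact ⟨v, w, h, nonneg_of_mul_nonneg_right hx.1 hs, nonneg_of_mul_nonneg_right hx.2.1 hs⟩

/-- Take a point of the edge interior to `Δ` and push it slightly counterclockwise. The triangle
containing the pushed point has `v` as a vertex, and the direction of the push shows that it starts
at `v`. -/
lemma exists_isNext (hΔ : IsPinwheel Δ O) (hv : v ∈ linkVertices Δ O) : ∃ w, IsNext Δ O v w := by
  obtain ⟨s, hs, hs1, hmem⟩ := hΔ.exists_scaled_mem_interior v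
  set y₀ := O + s • (v - O) with hy₀
  let J : Plane := !₂[-(v 1 - O 1), v 0 - O 0]
  have hc : Filter.Tendsto (fun δ : ℝ => y₀ + δ • J) (𝓝[>] 0) (𝓝 y₀) := by
    have : Continuous fun δ : ℝ => y₀ + δ • J := by fun_prop
    have h := this.tendsto 0
    simp only [zero_smul, add_zero] at h
    exact h.mono_left nhdsWithin_le_nhds
  have h1 := hc.eventually (isOpen_interior.mem_nhds hmem)
  -- The finitely many triangles that miss `y₀` are closed, so a small push does not reach them.
  have h2 : ∀ᶠ δ : ℝ in 𝓝[>] 0, ∀ t ∈ topSimplices Δ, y₀ ∉ convexHull ℝ (t : Set Plane) →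
      y₀ + δ • J ∉ convexHull ℝ (t : Set Plane) := by
    rw [Filter.eventually_all_finite hΔ.topSimplices_finite]
    intro t _
    by_cases ht : y₀ ∈ convexHull ℝ (t : Set Plane)
    · exact Filter.Eventually.of_forall fun _ h => absurd ht h
    · have hcl : IsClosed (convexHull ℝ (t : Set Plane)) := (t.finite_toSet.isClosed_convexHull ℝ)
      exact (hc.eventually (hcl.isOpen_compl.mem_nhds ht)).mono fun _ h _ => h
  have h3 : ∀ᶠ δ : ℝ in 𝓝[>] 0, 0 < δ := eventually_mem_nhdsWithin
  obtain ⟨δ, ⟨hδ1, hδ2⟩, hδ3⟩ := ((h1.and h2).and h3).exists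
  obtain ⟨a, b, h, hx⟩ := hΔ.exists_isNext_of_mem_space (interior_subset hδ1)
  have hy : y₀ ∈ convexHull ℝ (({O, a, b} : Finset Plane) : Set Plane) := by
    by_contra hcon
    refine hδ2 _ h.mem_topSimplices hcon ?_
    simpa only [Finset.coe_insert, Finset.coe_singleton] using hx
  have hyv : y₀ ∈ convexHull ℝ (({O, v} : Finset Plane) : Set Plane) := by
    simp only [Finset.coe_insert, Finset.coe_singleton, convexHull_pair]
    exact ⟨1 - s, s, by linarith, hs.le, by ring, by rw [hy₀]; module⟩
  have hvab : v = a ∨ v = b := by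
    by_contra hcon
    have h4 := Δ.inter_subset_convexHull h.1 hv.2 ⟨hy, hyv⟩
    have hsub : ((({O, a, b} : Finset Plane) : Set Plane) ∩ (({O, v} : Finset Plane) : Set Plane))
        ⊆ {O} := by
      rintro z ⟨hz, hz'⟩
      simp only [Finset.coe_insert, Finset.coe_singleton, Set.mem_insert_iff,
        Set.mem_singleton_iff] at hz hz' ⊢
      grind
    have h5 := convexHull_mono hsub h4
    rw [convexHull_singleton, Set.mem_singleton_iff, hy₀, add_eq_left, smul_eq_zero] at h5
    exact h5.elim hs.ne' (sub_ne_zero.2 hv.1)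
  rcases hvab with rfl | rfl
  · exact ⟨b, h⟩
  · exfalso
    have h6 := ((mem_triangle_iff h.2).1 hx).2.1
    have h7 : cross O (y₀ + δ • J) v = -(δ * ((v 0 - O 0) ^ 2 + (v 1 - O 1) ^ 2)) := by
      simp [hy₀, J, cross]; ring
    have h8 : 0 < (v 0 - O 0) ^ 2 + (v 1 - O 1) ^ 2 :=
      lt_of_le_of_ne (by positivity) ((plane_ne_iff O v).1 hv.1).symm
    have : 0 < δ * ((v 0 - O 0) ^ 2 + (v 1 - O 1) ^ 2) := by positivity
    linarith

lemma finite_linkVertices (hΔ : IsPinwheel Δ O) : (linkVertices Δ O).Finite := by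
  refine (hΔ.finite.biUnion fun s _ => s.finite_toSet).subset fun v hv => ?_
  simp only [Set.mem_iUnion]
  exact ⟨_, hv.2, by simp⟩

/-- The plane without `O` is connected. The cones over one cycle and the cones over all other cycles
are closed and cover it, so with two cycles they would meet away from `O`. Triangles meeting there
share a link vertex, hence a cycle. -/
lemma sameCycle (hΔ : IsPinwheel Δ O) (σ : Equiv.Perm (linkVertices Δ O))
    (hσ : ∀ v : linkVertices Δ O, IsNext Δ O v (σ v))
    (u w : linkVertices Δ O) : σ.SameCycle u w := by
  have := hΔ.finite_linkVertices.to_subtype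
  by_contra huw
  let cone : linkVertices Δ O → Set Plane := fun v => {y | 0 ≤ cross O v y ∧ 0 ≤ cross O y (σ v)}
  have hcone : ∀ v, IsClosed (cone v) := fun v =>
    (isClosed_le continuous_const (continuous_cross_right O v)).inter
      (isClosed_le continuous_const (continuous_cross_left O (σ v)))
  have hself : ∀ v : linkVertices Δ O, (v : Plane) ∈ cone v := fun v =>
    ⟨(cross_diag _ _).ge, (hσ v).2.le⟩
  have hconn : IsPreconnected ({O}ᶜ : Set Plane) :=
    (isConnected_compl_singleton_of_one_lt_rank
      (by rw [← finrank_eq_rank]; simp) O).isPreconnected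
  rw [isPreconnected_closed_iff] at hconn
  obtain ⟨y, hy0, hy1, hy2⟩ := hconn (⋃ v ∈ {v | σ.SameCycle u v}, cone v)
    (⋃ v ∈ {v | ¬ σ.SameCycle u v}, cone v)
    ((Set.toFinite _).isClosed_biUnion fun v _ => hcone v)
    ((Set.toFinite _).isClosed_biUnion fun v _ => hcone v) (by
      intro y _
      obtain ⟨a, b, h, h1, h2⟩ := hΔ.exists_cone y
      have hb : b = σ ⟨a, h.left_mem⟩ := h.right_unique (hσ ⟨a, h.left_mem⟩)
      have hmem : y ∈ cone ⟨a, h.left_mem⟩ := ⟨h1, by rw [← hb]; exact h2⟩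
      by_cases hs : σ.SameCycle u ⟨a, h.left_mem⟩
      · exact Or.inl (Set.mem_biUnion hs hmem)
      · exact Or.inr (Set.mem_biUnion hs hmem))
    ⟨u, u.2.1, Set.mem_biUnion (Equiv.Perm.SameCycle.refl σ u) (hself u)⟩
    ⟨w, w.2.1, Set.mem_biUnion huw (hself w)⟩
  simp only [Set.mem_iUnion] at hy1 hy2
  obtain ⟨v, hv, hyv⟩ := hy1
  obtain ⟨v', hv', hyv'⟩ := hy2
  obtain ⟨s, hs, hx, hx'⟩ :=
    (hσ v).exists_scaled_mem (hσ v') hyv.1 hyv.2 hyv'.1 hyv'.2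
  have hσv : σ.SameCycle u (σ v) := Equiv.Perm.sameCycle_apply_right.2 hv
  have hσv' : ¬ σ.SameCycle u (σ v') := fun h => hv' (Equiv.Perm.sameCycle_apply_right.1 h)
  have key : ∀ z z' : linkVertices Δ O, σ.SameCycle u z → ¬ σ.SameCycle u z' →
      (z : Plane) ≠ z' := fun z z' h h' he => h' (Subtype.ext he ▸ h)
  rcases (hσ v).inter_cases (hσ v') hx hx' with h0 | ⟨h0, -⟩ | ⟨h0 | h0, -⟩ | ⟨h0 | h0, -⟩
  · rw [add_eq_left, smul_eq_zero] at h0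
    exact h0.elim hs.ne' (sub_ne_zero.2 hy0)
  · exact key _ _ hv hv' h0
  · exact key _ _ hv hv' h0
  · exact key _ _ hv hσv' h0
  · exact key _ _ hσv hv' h0
  · exact key _ _ hσv hσv' h0

/-- The counterclockwise rotation of the link of the center of a pinwheel triangulation. -/
lemma exists_rotation (hΔ : IsPinwheel Δ O) : ∃ σ : Equiv.Perm (linkVertices Δ O),
    (∀ v : linkVertices Δ O, IsNext Δ O v (σ v)) ∧
    ∀ u w, ∃ k : ℕ, (σ ^ k) u = w := by
  have := hΔ.finite_linkVertices.to_subtype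
  choose f hf using fun v : linkVertices Δ O => hΔ.exists_isNext v.2
  let g : linkVertices Δ O → linkVertices Δ O := fun v => ⟨f v, (hf v).right_mem⟩
  have hg : Function.Injective g := by
    intro v v' h
    have h1 : f v = f v' := congrArg Subtype.val h
    exact Subtype.ext ((hf v).left_unique (h1 ▸ hf v'))
  refine ⟨Equiv.ofBijective g (Finite.injective_iff_bijective.1 hg), hf, fun u w => ?_⟩
  exact (hΔ.sameCycle _ hf u w).exists_nat_pow_eq

lemma nonempty_linkVertices (hΔ : IsPinwheel Δ O) : Nonempty (linkVertices Δ O) := by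
  obtain ⟨v, w, h, -⟩ := hΔ.exists_cone O
  exact ⟨⟨v, h.left_mem⟩⟩

lemma topSimplices_eq_range (hΔ : IsPinwheel Δ O) {σ : Equiv.Perm (linkVertices Δ O)}
    (hσ : ∀ v : linkVertices Δ O, IsNext Δ O v (σ v)) : topSimplices Δ =
      Set.range fun v : linkVertices Δ O => ({O, (v : Plane), (σ v : Plane)} : Finset Plane) := by
  ext t
  constructor
  · intro ht
    obtain ⟨v, w, h, rfl⟩ := exists_isNext_of_topSimplices ht (hΔ.center_mem_of_topSimplices ht)
    refine ⟨⟨v, h.left_mem⟩, ?_⟩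
    exact congrArg (fun z => ({O, v, z} : Finset Plane))
      (h.right_unique (hσ ⟨v, h.left_mem⟩)).symm
  · rintro ⟨v, rfl⟩
    exact (hσ v).mem_topSimplices

lemma ncard_topSimplices (hΔ : IsPinwheel Δ O) :
    (topSimplices Δ).ncard = Nat.card (linkVertices Δ O) := by
  obtain ⟨σ, hσ, -⟩ := hΔ.exists_rotation
  rw [hΔ.topSimplices_eq_range hσ, ← Set.image_univ, Set.ncard_image_of_injective,
    Set.ncard_univ]
  intro v v' h
  simp only at h
  have hv : (v : Plane) ∈ ({O, (v' : Plane), (σ v' : Plane)} : Finset Plane) := by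
    rw [← h]; simp
  have hw : (σ v : Plane) ∈ ({O, (v' : Plane), (σ v' : Plane)} : Finset Plane) := by
    rw [← h]; simp
  simp only [Finset.mem_insert, Finset.mem_singleton] at hv hw
  exact Subtype.ext ((hσ v).eq_of_mem (hσ v') (hv.resolve_left v.2.1)
    (hw.resolve_left (σ v).2.1)).1

end IsPinwheel

lemma linesAt_eq_image : linesAt Δ O =
    (fun v => affineSpan ℝ ({O, v} : Set Plane)) '' linkVertices Δ O := by
  ext L
  constructor
  · rintro ⟨s, hs, hc, hO, rfl⟩
    have hc' : (s.erase O).card = 1 := by rw [Finset.card_erase_of_mem hO, hc]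
    obtain ⟨v, hv⟩ := Finset.card_eq_one.1 hc'
    have hse : s = {O, v} := by rw [← Finset.insert_erase hO, hv]
    have hvO : v ≠ O := Finset.ne_of_mem_erase (s := s) (by rw [hv]; simp)
    refine ⟨v, ⟨hvO, hse ▸ hs⟩, ?_⟩
    simp [hse]
  · rintro ⟨v, hv, rfl⟩
    exact ⟨{O, v}, hv.2, Finset.card_pair hv.1.symm, by simp, by simp⟩

lemma affineSpan_pair_eq_iff (hv : v ≠ O) (hw : w ≠ O) :
    affineSpan ℝ ({O, v} : Set Plane) = affineSpan ℝ ({O, w} : Set Plane) ↔ cross O v w = 0 := by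
  constructor
  · intro h
    have hmem : w ∈ affineSpan ℝ ({O, v} : Set Plane) := by
      rw [h]; exact right_mem_affineSpan_pair ℝ O w
    obtain ⟨r, rfl⟩ := mem_affineSpan_pair_iff_exists_lineMap_eq.1 hmem
    simp [cross, AffineMap.lineMap_apply]
    ring
  · intro h
    have key : ∀ v w : Plane, v ≠ O → cross O v w = 0 →
        affineSpan ℝ ({O, w} : Set Plane) ≤ affineSpan ℝ ({O, v} : Set Plane) := by
      intro v w hv h
      obtain ⟨r, rfl⟩ := exists_smul_of_cross_eq_zero hv h
      refine affineSpan_pair_le_of_mem_of_mem (left_mem_affineSpan_pair ℝ O v) ?_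
      rw [mem_affineSpan_pair_iff_exists_lineMap_eq]
      exact ⟨r, by simp [AffineMap.lineMap_apply, add_comm]⟩
    exact le_antisymm (key w v hw (by rw [cross_swap, h, neg_zero])) (key v w hv h)

namespace IsPinwheel

lemma exists_two_lines (h : IsSingularVertex Δ O) : ∃ u w : linkVertices Δ O,
    cross O u w ≠ 0 ∧ ∀ v : linkVertices Δ O, cross O u v = 0 ∨ cross O w v = 0 := by
  obtain ⟨L, M, hLM, he⟩ := Set.ncard_eq_two.1 h.2.2.2
  rw [linesAt_eq_image] at he
  obtain ⟨u, hu, hL⟩ : L ∈ (fun v => affineSpan ℝ ({O, v} : Set Plane)) '' linkVertices Δ O := by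
    rw [he]; simp
  obtain ⟨w, hw, hM⟩ : M ∈ (fun v => affineSpan ℝ ({O, v} : Set Plane)) '' linkVertices Δ O := by
    rw [he]; simp
  simp only at hL hM
  refine ⟨⟨u, hu⟩, ⟨w, hw⟩, fun h0 => hLM ?_, fun v => ?_⟩
  · rw [← hL, ← hM, affineSpan_pair_eq_iff hu.1 hw.1]
    exact h0
  · have hv : affineSpan ℝ ({O, (v : Plane)} : Set Plane) ∈ ({L, M} : Set _) := by
      rw [← he]; exact ⟨v, v.2, rfl⟩
    rcases hv with hv | hv
    · left
      rw [← affineSpan_pair_eq_iff hu.1 v.2.1, hL, hv]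
    · right
      rw [← affineSpan_pair_eq_iff hw.1 v.2.1, hM, hv]

/-- If the edges at the center span at most two lines, the center is singular. -/
lemma isSingularVertex_of_two_lines (hΔ : IsPinwheel Δ O) {σ : Equiv.Perm (linkVertices Δ O)}
    (hσ : ∀ v : linkVertices Δ O, IsNext Δ O v (σ v)) (htrans : ∀ u w, ∃ k : ℕ, (σ ^ k) u = w)
    (v : linkVertices Δ O)
    (hlines : ∀ u : linkVertices Δ O, cross O v u = 0 ∨ cross O (σ v) u = 0) :
    IsSingularVertex Δ O := by
  have := hΔ.finite_linkVertices.to_subtype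
  have p1 := (hσ v).2
  have p2 := (hσ (σ v)).2
  have p3 := (hσ (σ (σ v))).2
  have p4 := (hσ (σ (σ (σ v)))).2
  have h2 := (hlines (σ (σ v))).resolve_right p2.ne'
  obtain ⟨c, hc⟩ := exists_smul_of_cross_eq_zero v.2.1 h2
  rw [hc, cross_smul_right, cross_swap] at p2
  -- Each pair of steps reverses the ray: `σ² v` is opposite to `v`, `σ³ v` to `σ v`, and `σ⁴ v` is
  -- back on the ray of `v`, hence equal to `v`.
  have hc0 : c < 0 := by nlinarith
  have h3 : cross O (σ v) (σ (σ (σ v))) = 0 := by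
    refine (hlines (σ (σ (σ v)))).resolve_left fun h => ?_
    rw [hc, cross_smul_left, h, mul_zero] at p3
    exact p3.false
  obtain ⟨e, he⟩ := exists_smul_of_cross_eq_zero (σ v).2.1 h3
  rw [hc, he, cross_smul_left, cross_smul_right] at p3
  have he0 : e < 0 := by
    by_contra! h
    have : c * (e * cross O v (σ v)) ≤ 0 :=
      mul_nonpos_of_nonpos_of_nonneg hc0.le (mul_nonneg h p1.le)
    linarith
  have h4 : cross O v (σ (σ (σ (σ v)))) = 0 := by
    refine (hlines (σ (σ (σ (σ v))))).resolve_right fun h => ?_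
    rw [he, cross_smul_left, h, mul_zero] at p4
    exact p4.false
  obtain ⟨f, hf⟩ := exists_smul_of_cross_eq_zero v.2.1 h4
  rw [he, hf, cross_smul_left, cross_smul_right, cross_swap] at p4
  have hf0 : 0 < f := by
    by_contra! h
    have : e * (f * -cross O v (σ v)) ≤ 0 := mul_nonpos_of_nonpos_of_nonneg he0.le
      (mul_nonneg_of_nonpos_of_nonpos h (by linarith))
    linarith
  have h5 : σ (σ (σ (σ v))) = v :=
    (Subtype.ext (linkVertex_eq_of_pos_smul v.2 (σ (σ (σ (σ v)))).2 hf0 hf)).symm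
  have hall : ∀ u, u = v ∨ u = σ v ∨ u = σ (σ v) ∨ u = σ (σ (σ v)) := by
    intro u
    obtain ⟨k, rfl⟩ := htrans v u
    induction k with
    | zero => simp
    | succ k ih =>
      rw [pow_succ', Equiv.Perm.mul_apply]
      rcases ih with h | h | h | h <;> rw [h]
      · simp
      · simp
      · simp
      · simp [h5]
  have n1 : v ≠ σ v := fun h => (hσ v).ne (congrArg Subtype.val h)
  have n2 : v ≠ σ (σ v) := fun h => by
    have := (hσ (σ v)).2
    rw [← h, cross_swap] at this
    linarith
  have n12 : σ v ≠ σ (σ v) := fun h => n1 (σ.injective h)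
  have n13 : σ v ≠ σ (σ (σ v)) := fun h => n2 (σ.injective h)
  have n23 : σ (σ v) ≠ σ (σ (σ v)) := fun h => n12 (σ.injective h)
  have n3 : v ≠ σ (σ (σ v)) := fun h => n1 ((congrArg σ h).trans h5).symm
  have hcard : Nat.card (linkVertices Δ O) = 4 := by
    rw [← Set.ncard_univ, show (Set.univ : Set (linkVertices Δ O)) =
      ({v, σ v, σ (σ v), σ (σ (σ v))} : Finset (linkVertices Δ O)) from ?_, Set.ncard_coe_finset]
    · simp [n1, n2, n3, n12, n13, n23]
    · ext u
      simpa using hall u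
  refine ⟨hΔ.center_mem, hΔ.center_interior, ?_, ?_⟩
  · rw [← hcard, ← hΔ.ncard_topSimplices]
    congr 1
    ext t
    exact ⟨fun h => h.1, fun h => ⟨h, hΔ.center_mem_of_topSimplices h⟩⟩
  · rw [Set.ncard_eq_two]
    refine ⟨affineSpan ℝ {O, (v : Plane)}, affineSpan ℝ {O, (σ v : Plane)}, ?_, ?_⟩
    · rw [Ne, affineSpan_pair_eq_iff v.2.1 (σ v).2.1]
      exact p1.ne'
    · rw [linesAt_eq_image]
      ext L
      simp only [Set.mem_image, Set.mem_insert_iff, Set.mem_singleton_iff]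
      constructor
      · rintro ⟨u, hu, rfl⟩
        refine (hlines ⟨u, hu⟩).imp (fun h => ?_) fun h => ?_
        · exact ((affineSpan_pair_eq_iff v.2.1 hu.1).2 h).symm
        · exact ((affineSpan_pair_eq_iff (σ v).2.1 hu.1).2 h).symm
      · rintro (rfl | rfl)
        · exact ⟨v, v.2, rfl⟩
        · exact ⟨σ v, (σ v).2, rfl⟩

/-- The edges to `v` and `σ v` already span two lines; if no third line occurs, every other edge
lies on one of these. -/
lemma exists_three_lines (hΔ : IsPinwheel Δ O) (h : ¬ IsSingularVertex Δ O) :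
    ∃ u v w : linkVertices Δ O,
    cross O u v ≠ 0 ∧ cross O u w ≠ 0 ∧ cross O v w ≠ 0 := by
  obtain ⟨σ, hσ, htrans⟩ := hΔ.exists_rotation
  obtain ⟨v⟩ := hΔ.nonempty_linkVertices
  by_contra! hcon
  refine h (hΔ.isSingularVertex_of_two_lines hσ htrans v fun u => ?_)
  by_contra! hu
  exact hu.2 (hcon v (σ v) u (hσ v).2.ne' hu.1)

end IsPinwheel

end Pinwheel

/-! ### Contact of order two along a line -/

section Flat

variable {O v w x : Plane} {p q : MvPolynomial (Fin 2) ℝ}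

lemma contDiff_evalAt (p : MvPolynomial (Fin 2) ℝ) {n : WithTop ℕ∞} :
    ContDiff ℝ n (evalAt p) := by
  induction p using MvPolynomial.induction_on with
  | C a =>
    have : evalAt (C a) = fun _ => a := by funext x; simp [evalAt]
    rw [this]; exact contDiff_const
  | add p q hp hq =>
    have : evalAt (p + q) = fun x => evalAt p x + evalAt q x := by
      funext x; exact evalAt_add p q x
    rw [this]; exact hp.add hq
  | mul_X p i hp =>
    have : evalAt (p * X i) = fun x => evalAt p x * x i := by
      funext x; simp [evalAt]
    rw [this]; exact hp.mul (by fun_prop)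

lemma differentiableAt_evalAt (p : MvPolynomial (Fin 2) ℝ) (x : Plane) :
    DifferentiableAt ℝ (evalAt p) x :=
  ((contDiff_evalAt p (n := 1)).differentiable one_ne_zero) x

/-- The polynomial vanishes to second order at the point. -/
def IsFlat (p : MvPolynomial (Fin 2) ℝ) (x : Plane) : Prop :=
  evalAt p x = 0 ∧ fderiv ℝ (evalAt p) x = 0

lemma fderiv_evalAt_add (p q : MvPolynomial (Fin 2) ℝ) (x : Plane) :
    fderiv ℝ (evalAt (p + q)) x = fderiv ℝ (evalAt p) x + fderiv ℝ (evalAt q) x := by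
  have : evalAt (p + q) = fun x => evalAt p x + evalAt q x := by
    funext x; exact evalAt_add p q x
  rw [this]
  exact fderiv_fun_add (differentiableAt_evalAt p x) (differentiableAt_evalAt q x)

lemma fderiv_evalAt_sub (p q : MvPolynomial (Fin 2) ℝ) (x : Plane) :
    fderiv ℝ (evalAt (p - q)) x = fderiv ℝ (evalAt p) x - fderiv ℝ (evalAt q) x := by
  rw [eq_sub_iff_add_eq, ← fderiv_evalAt_add, sub_add_cancel]

lemma fderiv_evalAt_mul (p q : MvPolynomial (Fin 2) ℝ) (x : Plane) :
    fderiv ℝ (evalAt (p * q)) x =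
      evalAt p x • fderiv ℝ (evalAt q) x + evalAt q x • fderiv ℝ (evalAt p) x := by
  have : evalAt (p * q) = fun x => evalAt p x * evalAt q x := by
    funext x; exact evalAt_mul p q x
  rw [this]
  exact fderiv_fun_mul (differentiableAt_evalAt p x) (differentiableAt_evalAt q x)

lemma isFlat_sub_iff : IsFlat (p - q) x ↔
    evalAt p x = evalAt q x ∧ fderiv ℝ (evalAt p) x = fderiv ℝ (evalAt q) x := by
  rw [IsFlat, evalAt_sub, fderiv_evalAt_sub, sub_eq_zero, sub_eq_zero]

lemma isFlat_sub_self : IsFlat (p - p) x := isFlat_sub_iff.2 ⟨rfl, rfl⟩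

lemma IsFlat.symm (h : IsFlat (p - q) x) : IsFlat (q - p) x := by
  rw [isFlat_sub_iff] at h ⊢
  exact ⟨h.1.symm, h.2.symm⟩

lemma IsFlat.trans {r : MvPolynomial (Fin 2) ℝ} (h : IsFlat (p - q) x) (h' : IsFlat (q - r) x) :
    IsFlat (p - r) x := by
  rw [isFlat_sub_iff] at h h' ⊢
  exact ⟨h.1.trans h'.1, h.2.trans h'.2⟩

lemma isFlat_of_sq_dvd (hp : evalAt p x = 0) (h : p ^ 2 ∣ q) : IsFlat q x := by
  obtain ⟨r, rfl⟩ := h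
  rw [sq, mul_assoc]
  refine ⟨by rw [evalAt_mul, hp, zero_mul], ?_⟩
  rw [fderiv_evalAt_mul, evalAt_mul, hp]
  simp

lemma fderiv_lineForm_ne_zero (hv : v ≠ O) (x : Plane) :
    fderiv ℝ (evalAt (lineForm O v)) x ≠ 0 := by
  have h1 : evalAt (lineForm O v) = fun x : Plane => (v 0 - O 0) * (x 1 - O 1) -
      (v 1 - O 1) * (x 0 - O 0) := by
    funext x; exact evalAt_lineForm O v x
  have hp : ∀ i : Fin 2, HasFDerivAt (fun x : Plane => x i)
      (EuclideanSpace.proj i : Plane →L[ℝ] ℝ) x := fun i =>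
    (EuclideanSpace.proj i : Plane →L[ℝ] ℝ).hasFDerivAt
  have h2 := (((hp 1).sub_const (O 1)).const_mul (v 0 - O 0)).sub
    (((hp 0).sub_const (O 0)).const_mul (v 1 - O 1))
  rw [h1]
  intro h4
  have h3 := h2.fderiv.symm.trans h4
  have h5 := DFunLike.congr_fun h3 (!₂[-(v 1 - O 1), v 0 - O 0] : Plane)
  simp at h5
  exact (plane_ne_iff O v).1 hv (by linear_combination h5)

lemma lineForm_dvd_of_vanish (hv : v ≠ O)
    (h : ∀ s : ℝ, 0 < s → s < 1 → evalAt p (O + s • (v - O)) = 0) : lineForm O v ∣ p := by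
  rw [lineForm_dvd_iff_restrictLine hv]
  refine Polynomial.eq_zero_of_infinite_isRoot _ ((Set.Ioo_infinite one_pos).mono fun s hs => ?_)
  change (restrictLine O v p).eval s = 0
  rw [eval_restrictLine]
  exact h s hs.1 hs.2

/-- Vanishing values give one factor. On the line, the derivative of the product is the cofactor
times the nonzero derivative of the form, so the cofactor vanishes there too. -/
lemma lineForm_sq_dvd_of_isFlat (hv : v ≠ O)
    (h : ∀ s : ℝ, 0 < s → s < 1 → IsFlat p (O + s • (v - O))) : lineForm O v ^ 2 ∣ p := by
  obtain ⟨q, rfl⟩ := lineForm_dvd_of_vanish hv fun s h0 h1 => (h s h0 h1).1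
  rw [sq]
  refine mul_dvd_mul_left _ (lineForm_dvd_of_vanish hv fun s h0 h1 => ?_)
  have h2 := (h s h0 h1).2
  rw [fderiv_evalAt_mul, evalAt_lineForm, cross_smul_right, cross_diag, mul_zero, zero_smul,
    zero_add, smul_eq_zero] at h2
  exact h2.resolve_right (fderiv_lineForm_ne_zero hv _)

lemma eq_zero_of_vanish_on_interior {s : Set Plane} (hs : (interior s).Nonempty)
    (h : ∀ x ∈ s, evalAt p x = 0) : p = 0 := by
  obtain ⟨x, hx⟩ := hs
  have hc : Continuous fun y : Fin 2 → ℝ => (WithLp.toLp 2 y : Plane) :=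
    PiLp.continuous_toLp 2 _
  have hnhds := (isOpen_interior.preimage hc).mem_nhds (show x.ofLp ∈ _ from hx)
  obtain ⟨ε, hε, hball⟩ := Metric.mem_nhds_iff.1 hnhds
  rw [ball_pi _ hε] at hball
  refine MvPolynomial.funext_set (fun i => Metric.ball (x.ofLp i) ε) (fun i => ?_) fun y hy => ?_
  · rw [Real.ball_eq_Ioo]
    exact Set.Ioo_infinite (by linarith)
  · rw [map_zero]
    exact h _ (interior_subset (hball hy))

lemma interior_triangle_nonempty (h : 0 < cross O v w) :
    (interior (convexHull ℝ ({O, v, w} : Set Plane))).Nonempty := by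
  have hopen : IsOpen ({x | 0 < cross O v x} ∩ {x | 0 < cross O x w} ∩
      {x | cross O v x + cross O x w < cross O v w}) :=
    ((isOpen_lt continuous_const (continuous_cross_right O v)).inter
      (isOpen_lt continuous_const (continuous_cross_left O w))).inter
      (isOpen_lt ((continuous_cross_right O v).add (continuous_cross_left O w)) continuous_const)
  refine ⟨O + (1 / 3 : ℝ) • (v - O) + (1 / 3 : ℝ) • (w - O),
    interior_maximal (fun x hx => ?_) hopen ?_⟩
  · rw [mem_triangle_iff h]
    exact ⟨hx.1.1.le, hx.1.2.le, hx.2.le⟩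
  · have h1 : cross O v (O + (1 / 3 : ℝ) • (v - O) + (1 / 3 : ℝ) • (w - O)) =
        1 / 3 * cross O v w := by simp [cross]; ring
    have h2 : cross O (O + (1 / 3 : ℝ) • (v - O) + (1 / 3 : ℝ) • (w - O)) w =
        1 / 3 * cross O v w := by simp [cross]; ring
    simp only [Set.mem_inter_iff, Set.mem_ofPred_eq, h1, h2]
    refine ⟨⟨?_, ?_⟩, ?_⟩ <;> linarith

end Flat

/-! ### Splines as tuples of polynomials -/

section Gluing

variable {Δ : SimplicialComplex ℝ Plane} {O : Plane} {d : ℕ}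
  {σ : Equiv.Perm (linkVertices Δ O)}

/-- The triangle spanned by `O`, `v` and the vertex following `v`. -/
def linkTriangle (σ : Equiv.Perm (linkVertices Δ O)) (v : linkVertices Δ O) : Set Plane :=
  convexHull ℝ {O, (v : Plane), (σ v : Plane)}

/-- Tuples of polynomials on the triangles whose differences across each interior edge are
divisible by the square of the linear form of that edge. -/
def smoothTuples (σ : Equiv.Perm (linkVertices Δ O)) (d : ℕ) :
    Submodule ℝ (linkVertices Δ O → PolyDeg d) :=
  cyclicSpace σ fun v => sqMultiples O d (σ v)

lemma isFlat_of_mem_smoothTuples (hσ : ∀ v : linkVertices Δ O, IsNext Δ O v (σ v))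
    (htrans : ∀ u w, ∃ k : ℕ, (σ ^ k) u = w)
    {p : linkVertices Δ O → PolyDeg d} (hp : p ∈ smoothTuples σ d) {u w : linkVertices Δ O}
    {x : Plane} (hu : x ∈ linkTriangle σ u) (hw : x ∈ linkTriangle σ w) :
    IsFlat ((p u : MvPolynomial (Fin 2) ℝ) - p w) x := by
  have step : ∀ (v : linkVertices Δ O) (x : Plane), cross O (σ v) x = 0 →
      IsFlat ((p (σ v) : MvPolynomial (Fin 2) ℝ) - p v) x := fun v x h =>
    isFlat_of_sq_dvd (p := lineForm O (σ v)) (by rw [evalAt_lineForm, h])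
      (mem_sqMultiples.1 (hp v))
  rcases (hσ u).inter_cases (hσ w) hu hw with rfl | ⟨h, -⟩ | ⟨h | h, h0⟩ | ⟨h | h, h0⟩
  -- Triangles without a common edge meet only at `O`, where all linear forms vanish; the 1-jet is
  -- carried from triangle to triangle along the cycle.
  · obtain ⟨k, rfl⟩ := htrans u w
    clear hu hw
    refine IsFlat.symm ?_
    induction k with
    | zero => exact isFlat_sub_self
    | succ k ih =>
      rw [pow_succ', Equiv.Perm.mul_apply]
      exact (step _ _ (cross_center _ _)).trans ih
  · rw [Subtype.ext h]; exact isFlat_sub_self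
  · rw [Subtype.ext h]; exact isFlat_sub_self
  · rw [Subtype.ext h]
    exact step w x (h ▸ h0)
  · rw [← Subtype.ext h]
    exact (step u x h0).symm
  · rw [σ.injective (Subtype.ext h)]; exact isFlat_sub_self

lemma linkTriangle_subset_space (hσ : ∀ v : linkVertices Δ O, IsNext Δ O v (σ v))
    (v : linkVertices Δ O) : linkTriangle σ v ⊆ Δ.space :=
  (hσ v).hull_subset_space

/-- Glue polynomials given on the triangles, using for each point a chosen triangle. -/
def glue (idx : Δ.space → linkVertices Δ O) (d : ℕ) :
    (linkVertices Δ O → PolyDeg d) →ₗ[ℝ] (Δ.space → ℝ) where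
  toFun p x := evalAt (p (idx x)) x
  map_add' p q := by funext x; exact evalAt_add _ _ _
  map_smul' c p := by funext x; simp [evalAt, smul_eval]

variable {idx : Δ.space → linkVertices Δ O}

lemma glue_apply_of_mem (hσ : ∀ v : linkVertices Δ O, IsNext Δ O v (σ v))
    (htrans : ∀ u w, ∃ k : ℕ, (σ ^ k) u = w)
    (hidx : ∀ x : Δ.space, (x : Plane) ∈ linkTriangle σ (idx x))
    {p : linkVertices Δ O → PolyDeg d} (hp : p ∈ smoothTuples σ d) {u : linkVertices Δ O}
    {x : Δ.space} (hu : (x : Plane) ∈ linkTriangle σ u) :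
    glue idx d p x = evalAt (p u) x :=
  (isFlat_sub_iff.1 (isFlat_of_mem_smoothTuples hσ htrans hp (hidx x) hu)).1

lemma hasFDerivWithinAt_biUnion {ι : Type*} {S : Set ι} (hS : S.Finite) {f : Plane → ℝ}
    {f' : Plane →L[ℝ] ℝ} {x : Plane} {T : ι → Set Plane}
    (h : ∀ i ∈ S, HasFDerivWithinAt f f' (T i) x) :
    HasFDerivWithinAt f f' (⋃ i ∈ S, T i) x := by
  induction S, hS using Set.Finite.induction_on with
  | empty => exact HasFDerivWithinAt.of_notMem_closure (by simp)
  | @insert a s _ _ ih =>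
    rw [Set.biUnion_insert]
    exact (h a (Set.mem_insert _ _)).union (ih fun i hi => h i (Set.mem_insert_of_mem _ hi))

lemma isClosed_linkTriangle (v : linkVertices Δ O) : IsClosed (linkTriangle σ v) :=
  Set.Finite.isClosed_convexHull ℝ (Set.toFinite _)

lemma extend_apply_of_mem (F : Δ.space → ℝ) {x : Plane} (hx : x ∈ Δ.space) :
    Function.extend Subtype.val F 0 x = F ⟨x, hx⟩ :=
  Subtype.val_injective.extend_apply F 0 ⟨x, hx⟩

lemma space_eq_iUnion (hσ : ∀ v : linkVertices Δ O, IsNext Δ O v (σ v))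
    (hidx : ∀ x : Δ.space, (x : Plane) ∈ linkTriangle σ (idx x)) :
    Δ.space = ⋃ v, linkTriangle σ v :=
  Set.Subset.antisymm (fun x hx => Set.mem_iUnion.2 ⟨_, hidx ⟨x, hx⟩⟩)
    (Set.iUnion_subset fun v => linkTriangle_subset_space hσ v)

/-- First-order agreement on overlaps makes the piecewise derivative well defined. Differentiability
and continuity then pass from the finitely many closed triangles to their union. -/
lemma isContDiffOnSpace_glue [Finite (linkVertices Δ O)]
    (hσ : ∀ v : linkVertices Δ O, IsNext Δ O v (σ v))
    (htrans : ∀ u w, ∃ k : ℕ, (σ ^ k) u = w)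
    (hidx : ∀ x : Δ.space, (x : Plane) ∈ linkTriangle σ (idx x))
    {p : linkVertices Δ O → PolyDeg d} (hp : p ∈ smoothTuples σ d) :
    IsContDiffOnSpace Δ 1 (glue idx d p) := by
  classical
  have hspace := space_eq_iUnion hσ hidx
  let f' : Plane → (Plane →L[ℝ] ℝ) := fun x =>
    if hx : x ∈ Δ.space then fderiv ℝ (evalAt (p (idx ⟨x, hx⟩))) x else 0
  have hf' : ∀ (u : linkVertices Δ O) (x : Plane), x ∈ linkTriangle σ u →
      f' x = fderiv ℝ (evalAt (p u)) x := by
    intro u x hx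
    have hxs := linkTriangle_subset_space hσ u hx
    simp only [f', dif_pos hxs]
    exact (isFlat_sub_iff.1 (isFlat_of_mem_smoothTuples hσ htrans hp (hidx ⟨x, hxs⟩) hx)).2
  have hG : ∀ (u : linkVertices Δ O) (x : Plane), x ∈ linkTriangle σ u →
      Function.extend Subtype.val (glue idx d p) 0 x = evalAt (p u) x := by
    intro u x hx
    rw [extend_apply_of_mem _ (linkTriangle_subset_space hσ u hx)]
    exact glue_apply_of_mem hσ htrans hidx hp hx
  unfold IsContDiffOnSpace
  have h01 : ((1 : ℕ) : WithTop ℕ∞) = 0 + 1 := by simp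
  rw [h01, contDiffOn_succ_iff_hasFDerivWithinAt (by simp)]
  intro x hx
  rw [Set.insert_eq_of_mem hx]
  refine ⟨Δ.space, self_mem_nhdsWithin, by simp, f', fun y hy => ?_, ?_⟩
  · refine HasFDerivWithinAt.mono (hasFDerivWithinAt_biUnion Set.finite_univ fun u _ => ?_)
      (hspace.trans (Set.biUnion_univ _).symm).subset
    by_cases hyu : y ∈ linkTriangle σ u
    · rw [hf' u y hyu]
      exact ((differentiableAt_evalAt _ y).hasFDerivAt.hasFDerivWithinAt).congr
        (fun z hz => hG u z hz) (hG u y hyu)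
    -- Away from a closed triangle, having a derivative within it is no condition.
    · exact HasFDerivWithinAt.of_notMem_closure
        (by rwa [(isClosed_linkTriangle u).closure_eq])
  · rw [contDiffOn_zero, hspace]
    refine (locallyFinite_of_finite _).continuousOn_iUnion isClosed_linkTriangle fun u => ?_
    refine ((contDiff_evalAt (p u : MvPolynomial (Fin 2) ℝ) (n := 1)).continuous_fderiv
      one_ne_zero).continuousOn.congr fun z hz => hf' u z hz

/-- A convex set with interior points determines derivatives even at its boundary, so both
polynomials inherit the derivative of `F` within `Δ.space`. -/
lemma fderiv_eq_of_isContDiffOnSpace {F : Δ.space → ℝ} (hF : IsContDiffOnSpace Δ 1 F)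
    {p q : MvPolynomial (Fin 2) ℝ} {s t : Set Plane}
    (hs : Convex ℝ s) (hs' : (interior s).Nonempty) (hsΔ : s ⊆ Δ.space)
    (ht : Convex ℝ t) (ht' : (interior t).Nonempty) (htΔ : t ⊆ Δ.space)
    (hp : ∀ x : Δ.space, (x : Plane) ∈ s → F x = evalAt p x)
    (hq : ∀ x : Δ.space, (x : Plane) ∈ t → F x = evalAt q x) {x : Plane}
    (hxs : x ∈ s) (hxt : x ∈ t) : IsFlat (p - q) x := by
  have hd := (hF.differentiableOn (by simp)) x (hsΔ hxs)
  have key : ∀ (r : MvPolynomial (Fin 2) ℝ) (u : Set Plane), Convex ℝ u → (interior u).Nonempty →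
      u ⊆ Δ.space → (∀ x : Δ.space, (x : Plane) ∈ u → F x = evalAt r x) → x ∈ u →
      fderiv ℝ (evalAt r) x =
        fderivWithin ℝ (Function.extend Subtype.val F 0) Δ.space x := by
    intro r u hu hu' huΔ hr hxu
    have h1 := (hd.hasFDerivWithinAt.mono huΔ).congr (f₁ := evalAt r)
      (fun z hz => by rw [extend_apply_of_mem F (huΔ hz), hr _ hz])
      (by rw [extend_apply_of_mem F (huΔ hxu), hr _ hxu])
    exact (uniqueDiffOn_convex hu hu' x hxu).eq
      (differentiableAt_evalAt r x).hasFDerivAt.hasFDerivWithinAt h1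
  rw [isFlat_sub_iff]
  exact ⟨(hp ⟨x, hsΔ hxs⟩ hxs).symm.trans (hq ⟨x, hsΔ hxs⟩ hxt),
    (key p s hs hs' hsΔ hp hxs).trans (key q t ht ht' htΔ hq hxt).symm⟩

open scoped Classical in
lemma map_glue_smoothTuples (hΔ : IsPinwheel Δ O)
    (hσ : ∀ v : linkVertices Δ O, IsNext Δ O v (σ v))
    (htrans : ∀ u w, ∃ k : ℕ, (σ ^ k) u = w)
    (hidx : ∀ x : Δ.space, (x : Plane) ∈ linkTriangle σ (idx x)) :
    (smoothTuples σ d).map (glue idx d) = splineSpace Δ 1 d := by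
  have := hΔ.finite_linkVertices.to_subtype
  ext F
  constructor
  · rintro ⟨p, hp, rfl⟩
    refine ⟨fun t ht => ?_, isContDiffOnSpace_glue hσ htrans hidx hp⟩
    rw [hΔ.topSimplices_eq_range hσ] at ht
    obtain ⟨u, rfl⟩ := ht
    refine ⟨p u, (mem_restrictTotalDegree _ _ _).1 (p u).2, fun x hx => ?_⟩
    refine glue_apply_of_mem hσ htrans hidx hp ?_
    simpa [linkTriangle] using hx
  · rintro ⟨hF1, hF2⟩
    choose p hpd hp using fun v : linkVertices Δ O => hF1 _ (hσ v).mem_topSimplices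
    have hp' : ∀ (v : linkVertices Δ O) (x : Δ.space), (x : Plane) ∈ linkTriangle σ v →
        F x = evalAt (p v) x := by
      intro v x hx
      refine hp v x ?_
      simpa [linkTriangle] using hx
    let P : linkVertices Δ O → PolyDeg d := fun v =>
      ⟨p v, (mem_restrictTotalDegree _ _ _).2 (hpd v)⟩
    refine ⟨P, fun v => ?_, ?_⟩
    · rw [mem_sqMultiples]
      refine lineForm_sq_dvd_of_isFlat (σ v).2.1 fun s hs0 hs1 => ?_
      have hseg : ∀ a : Set Plane, O ∈ a → ((σ v : linkVertices Δ O) : Plane) ∈ a →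
          O + s • (((σ v : linkVertices Δ O) : Plane) - O) ∈ convexHull ℝ a := by
        intro a ha ha'
        have := (convex_convexHull ℝ a) (subset_convexHull ℝ a ha) (subset_convexHull ℝ a ha')
          (show 0 ≤ 1 - s by linarith) hs0.le (by ring)
        convert this using 1
        module
      exact fderiv_eq_of_isContDiffOnSpace hF2 (convex_convexHull ℝ _)
        (interior_triangle_nonempty (hσ (σ v)).2) (hσ (σ v)).hull_subset_space
        (convex_convexHull ℝ _) (interior_triangle_nonempty (hσ v).2) (hσ v).hull_subset_space
        (hp' (σ v)) (hp' v) (hseg _ (by simp) (by simp)) (hseg _ (by simp) (by simp))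
    · funext x
      exact (hp' _ x (hidx x)).symm

lemma rank_splineSpace (hΔ : IsPinwheel Δ O)
    (hσ : ∀ v : linkVertices Δ O, IsNext Δ O v (σ v))
    (htrans : ∀ u w, ∃ k : ℕ, (σ ^ k) u = w) (d : ℕ) :
    Module.rank ℝ (splineSpace Δ 1 d) = (finrank ℝ (smoothTuples σ d) : ℕ) := by
  have := hΔ.finite_linkVertices.to_subtype
  have hcov : ∀ x : Δ.space, ∃ v, (x : Plane) ∈ linkTriangle σ v := by
    intro x
    obtain ⟨v, w, h, hx⟩ := hΔ.exists_isNext_of_mem_space x.2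
    refine ⟨⟨v, h.left_mem⟩, ?_⟩
    rw [h.right_unique (hσ ⟨v, h.left_mem⟩)] at hx
    exact hx
  choose idx hidx using hcov
  -- A polynomial is determined by its values on a triangle, which has interior points.
  have hinj : Set.InjOn (glue idx d) (smoothTuples σ d) := by
    intro p hp q hq hpq
    funext v
    have h0 : glue idx d (p - q) = 0 := by rw [map_sub, hpq, sub_self]
    have h1 := eq_zero_of_vanish_on_interior (p := ((p - q) v : MvPolynomial (Fin 2) ℝ))
      (interior_triangle_nonempty (hσ v).2) fun x hx => by
        have h2 := glue_apply_of_mem hσ htrans hidx (sub_mem hp hq)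
          (x := ⟨x, linkTriangle_subset_space hσ v hx⟩) hx
        rw [h0] at h2
        exact h2.symm
    exact sub_eq_zero.1 (Subtype.ext h1 : (p - q) v = 0)
  let e : smoothTuples σ d ≃ₗ[ℝ] splineSpace Δ 1 d :=
    (LinearEquiv.ofInjective ((glue idx d).domRestrict (smoothTuples σ d))
      fun p q h => Subtype.ext (hinj p.2 q.2 h)).trans
      (LinearEquiv.ofEq _ _ (by
        rw [LinearMap.range_domRestrict, map_glue_smoothTuples hΔ hσ htrans hidx]))
  have := Module.Finite.equiv e
  rw [← finrank_eq_rank', e.finrank_eq]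

end Gluing

/-! ### The dimension count -/

section Dimension

variable {Δ : SimplicialComplex ℝ Plane} {O : Plane} {d : ℕ}

/-- The dimension count for splines on a pinwheel triangulation, in terms of the subspaces of
multiples of squared linear forms. -/
lemma exists_rank_splineSpace (hΔ : IsPinwheel Δ O) (d : ℕ) :
    ∃ r : ℕ, Module.rank ℝ (splineSpace Δ 1 d) = r ∧ ∀ k,
      (∀ v : linkVertices Δ O, finrank ℝ (sqMultiples O d (v : Plane)) = k) →
      r + finrank ℝ (⨆ v : linkVertices Δ O, sqMultiples O d v : Submodule ℝ (PolyDeg d)) =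
        numMonomials d + (topSimplices Δ).ncard * k := by
  obtain ⟨σ, hσ, htrans⟩ := hΔ.exists_rotation
  have := hΔ.finite_linkVertices.to_subtype
  have := Fintype.ofFinite (linkVertices Δ O)
  have := hΔ.nonempty_linkVertices
  refine ⟨_, rank_splineSpace hΔ hσ htrans d, fun k hk => ?_⟩
  have h := finrank_cyclicSpace htrans fun v => sqMultiples O d (σ v : Plane)
  -- The edge between consecutive triangles is indexed by `σ v`; reindexing by `σ` changes neither
  -- the sum of the subspaces nor their dimensions.
  rw [Equiv.iSup_comp (g := fun v : linkVertices Δ O => sqMultiples O d (v : Plane)) σ,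
    Finset.sum_congr rfl fun v _ => hk (σ v), Finset.sum_const, Finset.card_univ,
    finrank_polyDeg, smul_eq_mul, ← Nat.card_eq_fintype_card, ← hΔ.ncard_topSimplices] at h
  exact h

lemma rank_splineSpace_of_le_one (hΔ : IsPinwheel Δ O) (hd : d ≤ 1) :
    Module.rank ℝ (splineSpace Δ 1 d) = (numMonomials d : ℕ) := by
  obtain ⟨r, hr, h⟩ := exists_rank_splineSpace hΔ d
  have hbot : ∀ v : linkVertices Δ O, sqMultiples O d (v : Plane) = ⊥ := fun v =>
    sqMultiples_eq_bot v.2.1 hd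
  have h0 := h 0 fun v => by rw [hbot, finrank_bot]
  rw [iSup_congr hbot, iSup_bot, finrank_bot] at h0
  rw [hr]
  congr 1

lemma IsPinwheel.iSup_sqMultiples_of_singular (h : IsSingularVertex Δ O) (d : ℕ) :
    ∃ u w : Plane, cross O u w ≠ 0 ∧
      (⨆ v : linkVertices Δ O, sqMultiples O d v : Submodule ℝ (PolyDeg d)) =
        sqMultiples O d u ⊔ sqMultiples O d w := by
  obtain ⟨u, w, huw, hall⟩ := IsPinwheel.exists_two_lines h
  refine ⟨u, w, huw, le_antisymm (iSup_le fun v => ?_) (sup_le ?_ ?_)⟩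
  · rcases hall v with h | h
    · rw [← sqMultiples_eq_of_cross_eq_zero u.2.1 v.2.1 h]
      exact le_sup_left
    · rw [← sqMultiples_eq_of_cross_eq_zero w.2.1 v.2.1 h]
      exact le_sup_right
  · exact le_iSup (fun v : linkVertices Δ O => sqMultiples O d (v : Plane)) u
  · exact le_iSup (fun v : linkVertices Δ O => sqMultiples O d (v : Plane)) w

/-- The sum of the `n` subspaces has dimension `m_d - 3`, so `m_d` cancels from the count. -/
lemma rank_splineSpace_of_not_singular (hΔ : IsPinwheel Δ O) (h : ¬ IsSingularVertex Δ O)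
    (hd : 2 ≤ d) : Module.rank ℝ (splineSpace Δ 1 d) =
      ((topSimplices Δ).ncard * numMonomials (d - 2) + 3 : ℕ) := by
  obtain ⟨r, hr, hcount⟩ := exists_rank_splineSpace hΔ d
  obtain ⟨u, v, w, huv, huw, hvw⟩ := hΔ.exists_three_lines h
  have h1 := hcount _ fun v => finrank_sqMultiples v.2.1 hd
  rw [iSup_sqMultiples_eq (f := fun v : linkVertices Δ O => (v : Plane)) (fun v => v.2.1)
    huv huw hvw hd] at h1
  have h2 := finrank_ker_oneJet O (d := d) (by omega)
  rw [hr]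
  congr 1
  omega

/-- With `d = e + 3`, this converts `n m_{d-2} + 3` into the stated form with `2 m_{d-3}`. -/
lemma numMonomials_add_two_mul (e : ℕ) :
    numMonomials (e + 3) + 2 * numMonomials e = 3 * numMonomials (e + 1) + 3 := by
  simp only [numMonomials_succ]
  ring

end Dimension

end

theorem corollary5p12
    (Δ : Geometry.SimplicialComplex ℝ (EuclideanSpace ℝ (Fin 2)))
    (O : EuclideanSpace ℝ (Fin 2)) (hΔ : IsPinwheel Δ O)
    (n : ℕ) (hn : (topSimplices Δ).ncard = n) (d : ℕ) :
    (n = 4 → IsSingularVertex Δ O →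
      (d ≤ 1 → Module.rank ℝ (splineSpace Δ 1 d) = (numMonomials d : ℕ)) ∧
      (2 ≤ d ∧ d ≤ 3 → Module.rank ℝ (splineSpace Δ 1 d) =
        (numMonomials d + 2 * numMonomials (d - 2) : ℕ)) ∧
      (4 ≤ d → Module.rank ℝ (splineSpace Δ 1 d) =
        (numMonomials d + 2 * numMonomials (d - 2) + numMonomials (d - 4) : ℕ))) ∧
    (3 ≤ n → ¬ IsSingularVertex Δ O →
      (d ≤ 1 → Module.rank ℝ (splineSpace Δ 1 d) = (numMonomials d : ℕ)) ∧
      (d = 2 → Module.rank ℝ (splineSpace Δ 1 d) =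
        (numMonomials d + (n - 3) * numMonomials (d - 2) : ℕ)) ∧
      (3 ≤ d → Module.rank ℝ (splineSpace Δ 1 d) =
        (numMonomials d + (n - 3) * numMonomials (d - 2) + 2 * numMonomials (d - 3) : ℕ))) := by
  subst hn
  refine ⟨fun h4 hs => ⟨rank_splineSpace_of_le_one hΔ, fun hd => ?_, fun hd => ?_⟩,
    fun h3 hs => ⟨rank_splineSpace_of_le_one hΔ, ?_, fun hd => ?_⟩⟩
  · obtain ⟨r, hr, hcount⟩ := exists_rank_splineSpace hΔ d
    obtain ⟨u, w, huw, hsup⟩ := IsPinwheel.iSup_sqMultiples_of_singular hs d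
    have h1 := hcount _ fun v => finrank_sqMultiples v.2.1 hd.1
    rw [hsup, finrank_sqMultiples_sup_of_le huw hd.1 hd.2, h4] at h1
    rw [hr]
    congr 1
    omega
  · obtain ⟨r, hr, hcount⟩ := exists_rank_splineSpace hΔ d
    obtain ⟨u, w, huw, hsup⟩ := IsPinwheel.iSup_sqMultiples_of_singular hs d
    have h1 := hcount _ fun v => finrank_sqMultiples v.2.1 (by omega)
    have h2 := finrank_sqMultiples_sup huw hd
    rw [hsup, h4] at h1
    rw [hr]
    congr 1
    omega
  · rintro rfl
    rw [rank_splineSpace_of_not_singular hΔ hs le_rfl]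
    congr 1
    simp only [numMonomials]
    omega
  · rw [rank_splineSpace_of_not_singular hΔ hs (by omega)]
    congr 1
    obtain ⟨e, rfl⟩ := Nat.exists_eq_add_of_le' hd
    -- Writing the number of triangles as `m + 3` removes the truncated subtraction.
    obtain ⟨m, hm⟩ := Nat.exists_eq_add_of_le' h3
    have h5 := numMonomials_add_two_mul e
    rw [hm, show e + 3 - 2 = e + 1 by omega, Nat.add_sub_cancel, Nat.add_sub_cancel, add_mul]
    omega
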